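/- A graph-controlled insertion-deletion system with $k$ components is a tuple $\Pi=(k,V,T,A,i_0,i_f,R)$, where $V$ is a finite alphabet, $T\subseteq V$ is the terminal alphabet, $A\subseteq V^*$ is a finite set of axioms, $i_0,i_f\in\{1,\dots,k\}$ are the initial and the final component, and $R$ is a finite set of rules $(i,r,j)$ with $i,j\in\{1,\dots,k\}$ and $r$ an insertion rule $(u,\alpha,v)_{ins}$, which rewrites a string $x_1uvx_2$ to $x_1u\alpha vx_2$, or a deletion rule $(u,\alpha,v)_{del}$, which rewrites $x_1u\alpha vx_2$ to $x_1uvx_2$ (here $u,\alpha,v\in V^*$ and $\alpha\neq\lambda$, where $\lambda$ is the empty string). A configuration is a pair $(i,w)$ with $1\le i\le k$ and $w\in V^*$; there is a transition $(i,w)\Rrightarrow(j,w')$ if $r$ rewrites $w$ to $w'$ for some $(i,r,j)\in R$. The language generated by $\Pi$ is $$L(\Pi)=\{w\in T^*\mid (i_0,x)\Rrightarrow^*(i_f,w)\text{ for some }x\in A\}.$$ The communication graph of $\Pi$ has the nodes $1,\dots,k$ and an edge from $i$ to $j$ whenever $R$ contains a rule $(i,r,j)$; it has a tree structure if, with orientations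 and loops disregarded, it is a tree, and it is linear if it is moreover a path through all nodes. Let $TCL_k(ins_n^{m,m'},del_p^{q,q'})$ be the family of languages generated by such systems with at most $k$ components and a communication graph with a tree structure in which every insertion rule $(u,\alpha,v)_{ins}$ satisfies $|\alpha|\le n$, $|u|\le m$, $|v|\le m'$ and every deletion rule $(u,\alpha,v)_{del}$ satisfies $|\alpha|\le p$, $|u|\le q$, $|v|\le q'$. Let $RE$ be the family of recursively enumerable languages over finite alphabets. **Theorem 1.** $TCL_4(ins_1^{1,0},del_2^{0,0})=RE$. The equality remains true if in the definition of the family on the left the communication graph is required to be linear. -/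

import Mathlib

namespace InsDel

universe u

/-- The two types of rules: insertion and deletion. -/
inductive Kind
  | ins
  | del

/-- An insertion or deletion rule `(left, str, right)_kind` over the alphabet `V`, with `str`
different from the empty string. -/
structure Rule (V : Type) where
  /-- Insertion or deletion. -/
  kind : Kind
  /-- The left context. -/
  left : List V
  /-- The string that is inserted or deleted. -/
  str : List V
  /-- The right context. -/
  right : List V
  /-- The inserted or deleted string is not empty. -/
  str_ne_nil : str ≠ []

/-- `r.Rewrites x y`: the string `y` is obtained from `x` by one application of the rule `r`.
An insertion rule `(u, α, v)` rewrites `u v` to `u α v`, a deletion rule rewrites `u α v`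
to `u v`. -/
def Rule.Rewrites {V : Type} (r : Rule V) (x y : List V) : Prop :=
  match r.kind with
  | Kind.ins => ∃ x₁ x₂ : List V,
      x = x₁ ++ r.left ++ r.right ++ x₂ ∧ y = x₁ ++ r.left ++ r.str ++ r.right ++ x₂
  | Kind.del => ∃ x₁ x₂ : List V,
      x = x₁ ++ r.left ++ r.str ++ r.right ++ x₂ ∧ y = x₁ ++ r.left ++ r.right ++ x₂

/-- A graph-controlled insertion-deletion system with `k` components and terminal alphabet `T`.
The inclusion of `T` in the alphabet `V` is the injection `terminal`, and the components are
numbered by `Fin k`. A controlled rule `(i, r, j)` belongs to component `i`, applies `r` and sends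
the string to component `j`. -/
structure GCSystem (T : Type u) (k : ℕ) where
  /-- The alphabet. -/
  V : Type
  /-- The alphabet is finite. -/
  finite_alphabet : Finite V
  /-- The terminal symbols as symbols of the alphabet. -/
  terminal : T ↪ V
  /-- The initial strings (the set `A`). -/
  initials : Set (List V)
  /-- There are finitely many initial strings. -/
  finite_initials : initials.Finite
  /-- The initial component. -/
  initialComp : Fin k
  /-- The final component. -/
  finalComp : Fin k
  /-- The controlled rules `(i, r, j)`. -/
  rules : Set (Fin k × Rule V × Fin k)
  /-- There are finitely many rules. -/
  finite_rules : rules.Finite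

namespace GCSystem

variable {T : Type u} {k : ℕ}

/-- One transition between configurations: a rule of the current component is applied and the
string moves to the target component of that rule. -/
def Step (P : GCSystem T k) (c d : Fin k × List P.V) : Prop :=
  ∃ r : Rule P.V, (c.1, r, d.1) ∈ P.rules ∧ r.Rewrites c.2 d.2

/-- The language of the system: the terminal strings that are reachable, in the final component,
from an initial string in the initial component. -/
def language (P : GCSystem T k) : Language T :=
  {w : List T | ∃ x ∈ P.initials,
    Relation.ReflTransGen P.Step (P.initialComp, x) (P.finalComp, w.map P.terminal)}

/-- The edges of the (directed) communication graph: there is an edge from `i` to `j` if some rule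
of component `i` has the target component `j`. -/
def Edge (P : GCSystem T k) (i j : Fin k) : Prop :=
  ∃ r : Rule P.V, (i, r, j) ∈ P.rules

/-- The communication graph without orientation and loops. -/
def commGraph (P : GCSystem T k) : SimpleGraph (Fin k) :=
  SimpleGraph.fromRel P.Edge

/-- The size of the system is at most `(n, m, m'; p, q, q')`. -/
def SizeLE (P : GCSystem T k) (n m m' p q q' : ℕ) : Prop :=
  ∀ i r j, (i, r, j) ∈ P.rules →
    match r.kind with
    | Kind.ins => r.str.length ≤ n ∧ r.left.length ≤ m ∧ r.right.length ≤ m'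
    | Kind.del => r.str.length ≤ p ∧ r.left.length ≤ q ∧ r.right.length ≤ q'

end GCSystem

/-- The family `TCL_k(ins_n^{m,m'}, del_p^{q,q'})` over the terminal alphabet `T`: the languages
of systems with at most `k` components, size at most `(n, m, m'; p, q, q')` and a communication
graph that is a tree. -/
def TCL (T : Type u) (k n m m' p q q' : ℕ) : Set (Language T) :=
  {L | ∃ l ≤ k, ∃ P : GCSystem T l,
    P.commGraph.IsTree ∧ P.SizeLE n m m' p q q' ∧ P.language = L}

/-- As `TCL`, with a communication graph that is linear, that is, a path through all
components. -/
def LinearTCL (T : Type u) (k n m m' p q q' : ℕ) : Set (Language T) :=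
  {L | ∃ l ≤ k, ∃ P : GCSystem T l,
    Nonempty (P.commGraph ≃g SimpleGraph.pathGraph l) ∧ P.SizeLE n m m' p q q' ∧ P.language = L}

/-- The recursively enumerable languages over `T`. -/
def RE (T : Type u) [Primcodable T] : Set (Language T) :=
  {L | REPred fun w : List T => w ∈ L}

end InsDel

/-! A derivation is a finite list of rule applications whose correctness is decidable, so unbounded
search shows every generated language to be recursively enumerable (`GCSystem.language_mem_RE`).

For the converse, strings have the form `u s v` with a single active symbol `s`, the state of a
finite automaton that extends `u` at its right end or `v` at its left end. Contextless deletion can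
compare the two words: once `s` is gone, matching letters cancel at the junction of `u` and `v`, and
a terminal word `w` remains exactly when `u = l` and `v` is the reverse of `l` followed by `w`.
Replacing `s` takes two trips through the components 0, 1, 2, 3, 2, 1, 0. The auxiliary symbols name
the transition and the stage, so an intermediate string has only one continuation (`Good.step`,
`mem_language_toGCSystem`).

Comparing two words suffices for all of `RE`: `l` records the letters appended to a queue, the right
word the letters removed from it, and their agreement says that the queue is first in, first out
(`QueueSystem.accepts_iff`). The input is guessed on the way: its letters go to the right, their
codes into the queue. A queue simulates a Turing machine by holding its tape as a cyclic word
(`accepts_queueSystem_iff`). It remains to find, for a recursively enumerable language, a finite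
Turing machine whose input is coded letter by letter (`exists_machine_of_rePred`). -/

namespace InsDel

/-! ### Linear automata and the insertion-deletion systems that simulate them -/

/-- A finite automaton that writes a word on the left, letter by letter from left to right, and a
word on the right, letter by letter from right to left. -/
structure LinearAutomaton (Γ ρ : Type) where
  /-- The states. -/
  State : Type
  /-- The transitions. -/
  Trans : Type
  [finite_state : Finite State]
  [finite_trans : Finite Trans]
  [nonempty_trans : Nonempty Trans]
  /-- The source of a transition. -/
  source : Trans → State
  /-- The target of a transition. -/
  target : Trans → State
  /-- The letter that is written. -/
  emit : Trans → Γ ⊕ ρ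
  /-- The initial state. -/
  start : State
  /-- The final state. -/
  final : State

namespace LinearAutomaton

attribute [instance] finite_state finite_trans nonempty_trans

variable {Γ ρ : Type}

/-- The effect of writing a letter. -/
def write : Γ ⊕ ρ → List Γ × List ρ → List Γ × List ρ
  | .inl a, p => (p.1 ++ [a], p.2)
  | .inr b, p => (p.1, b :: p.2)

/-- `G.Reach s p`: the automaton can get to the state `s` while writing the two words of `p`. -/
inductive Reach (G : LinearAutomaton Γ ρ) : G.State → List Γ × List ρ → Prop
  | start : Reach G G.start ([], [])
  | step (r : G.Trans) {p} : Reach G (G.source r) p → Reach G (G.target r) (write (G.emit r) p)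

/-- The alphabet of the insertion-deletion system of a linear automaton. -/
inductive Letter (G : LinearAutomaton Γ ρ)
  | lft (a : Γ)
  | rgt (b : ρ)
  | st (s : G.State)
  | br (r : G.Trans)
  | a₀ (r : G.Trans)
  | a₁ (r : G.Trans)
  | a₂ (r : G.Trans)
  | b₀ (r : G.Trans)
  | b₁ (r : G.Trans)

open Letter

instance [Finite Γ] [Finite ρ] (G : LinearAutomaton Γ ρ) : Finite G.Letter := by
  let f : Γ ⊕ ρ ⊕ G.State ⊕ G.Trans × Fin 6 → G.Letter := fun x ↦ match x with
    | .inl a => lft a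
    | .inr (.inl b) => rgt b
    | .inr (.inr (.inl s)) => st s
    | .inr (.inr (.inr (r, i))) => ![br r, a₀ r, a₁ r, a₂ r, b₀ r, b₁ r] i
  refine Finite.of_surjective f fun x ↦ ?_
  cases x with
  | lft a => exact ⟨.inl a, rfl⟩
  | rgt b => exact ⟨.inr (.inl b), rfl⟩
  | st s => exact ⟨.inr (.inr (.inl s)), rfl⟩
  | br r => exact ⟨.inr (.inr (.inr (r, 0))), rfl⟩
  | a₀ r => exact ⟨.inr (.inr (.inr (r, 1))), rfl⟩
  | a₁ r => exact ⟨.inr (.inr (.inr (r, 2))), rfl⟩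
  | a₂ r => exact ⟨.inr (.inr (.inr (r, 3))), rfl⟩
  | b₀ r => exact ⟨.inr (.inr (.inr (r, 4))), rfl⟩
  | b₁ r => exact ⟨.inr (.inr (.inr (r, 5))), rfl⟩

variable (G : LinearAutomaton Γ ρ)

/-- The symbol that is inserted first when the transition `r` is simulated. -/
def fst (r : G.Trans) : G.Letter :=
  match G.emit r with
  | .inl _ => st (G.target r)
  | .inr b => rgt b

/-- The symbol that is inserted second when the transition `r` is simulated. -/
def snd (r : G.Trans) : G.Letter :=
  match G.emit r with
  | .inl a => lft a
  | .inr _ => st (G.target r)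

end LinearAutomaton

/-- The rule that inserts `a` after `c`. -/
def insAfter {V : Type} (c a : V) : Rule V := ⟨.ins, [c], [a], [], by simp⟩

/-- The rule that deletes `a`. -/
def delOne {V : Type} (a : V) : Rule V := ⟨.del, [], [a], [], by simp⟩

/-- The rule that deletes `a b`. -/
def delTwo {V : Type} (a b : V) : Rule V := ⟨.del, [], [a, b], [], by simp⟩

theorem insAfter_rewrites {V : Type} {c a : V} {x y : List V} :
    (insAfter c a).Rewrites x y ↔
      ∃ x₁ x₂, x = x₁ ++ c :: x₂ ∧ y = x₁ ++ c :: a :: x₂ := by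
  simp [Rule.Rewrites, insAfter]

theorem delOne_rewrites {V : Type} {a : V} {x y : List V} :
    (delOne a).Rewrites x y ↔ ∃ x₁ x₂, x = x₁ ++ a :: x₂ ∧ y = x₁ ++ x₂ := by
  simp [Rule.Rewrites, delOne]

theorem delTwo_rewrites {V : Type} {a b : V} {x y : List V} :
    (delTwo a b).Rewrites x y ↔ ∃ x₁ x₂, x = x₁ ++ a :: b :: x₂ ∧ y = x₁ ++ x₂ := by
  simp [Rule.Rewrites, delTwo]

namespace LinearAutomaton

open Letter

variable {Γ τ : Type} (G : LinearAutomaton Γ (Γ ⊕ τ))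

/-- The controlled rules of the insertion-deletion system of a linear automaton. -/
inductive Controlled : Fin 4 → Rule G.Letter → Fin 4 → Prop
  | a01 (r) : Controlled 0 (insAfter (st (G.source r)) (a₀ r)) 1
  | b01 (r) : Controlled 0 (insAfter (br r) (b₀ r)) 1
  | a12 (r) : Controlled 1 (insAfter (a₀ r) (a₁ r)) 2
  | b12 (r) : Controlled 1 (insAfter (b₀ r) (G.fst r)) 2
  | a23 (r) : Controlled 2 (delTwo (st (G.source r)) (a₀ r)) 3
  | b23 (r) : Controlled 2 (delOne (b₀ r)) 3
  | a32 (r) : Controlled 3 (insAfter (a₁ r) (a₂ r)) 2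
  | b32 (r) : Controlled 3 (insAfter (br r) (b₁ r)) 2
  | a21 (r) : Controlled 2 (insAfter (a₂ r) (br r)) 1
  | b21 (r) : Controlled 2 (insAfter (b₁ r) (G.snd r)) 1
  | a10 (r) : Controlled 1 (delTwo (a₁ r) (a₂ r)) 0
  | b10 (r) : Controlled 1 (delTwo (br r) (b₁ r)) 0
  | final : Controlled 0 (delOne (st G.final)) 0
  | cancel (a) : Controlled 0 (delTwo (lft a) (rgt (.inl a))) 0

/-- The insertion-deletion system of a linear automaton. -/
abbrev toGCSystem [Finite Γ] [Finite τ] : GCSystem τ 4 where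
  V := G.Letter
  finite_alphabet := inferInstance
  terminal := ⟨fun t ↦ rgt (.inr t), fun _ _ h ↦ by simpa using h⟩
  initials := {[st G.start]}
  finite_initials := Set.finite_singleton _
  initialComp := 0
  finalComp := 0
  rules := {x | G.Controlled x.1 x.2.1 x.2.2}
  finite_rules := by
    have hl : {l : List G.Letter | l.length ≤ 2}.Finite := List.finite_length_le _ 2
    have hr : {r : Rule G.Letter |
        r.left.length ≤ 2 ∧ r.str.length ≤ 2 ∧ r.right.length ≤ 2}.Finite := by
      have hk : (Set.univ : Set Kind).Finite :=
        Set.Finite.subset (Set.toFinite {.ins, .del}) fun k _ ↦ by cases k <;> simp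
      refine Set.Finite.of_finite_image ((hk.prod (hl.prod (hl.prod hl))).subset ?_)
        (f := fun r ↦ (r.kind, r.left, r.str, r.right)) ?_
      · rintro _ ⟨r, h, rfl⟩
        exact ⟨trivial, h⟩
      · rintro ⟨⟩ - ⟨⟩ - h
        simpa using h
    refine (Set.finite_univ.prod (hr.prod Set.finite_univ)).subset ?_
    rintro ⟨i, r, j⟩ h
    refine ⟨trivial, ?_, trivial⟩
    have h : G.Controlled i r j := h
    cases h <;> simp [insAfter, delOne, delTwo]

theorem toGCSystem_sizeLE [Finite Γ] [Finite τ] : G.toGCSystem.SizeLE 1 1 0 2 0 0 := by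
  intro i r j h
  have h : G.Controlled i r j := h
  cases h <;> simp [insAfter, delOne, delTwo]

/-- No rule moves the string by more than one component; a single transition already supplies the
three edges of the path, which is why transitions must exist. -/
theorem toGCSystem_commGraph [Finite Γ] [Finite τ] :
    G.toGCSystem.commGraph = SimpleGraph.pathGraph 4 := by
  obtain ⟨r⟩ := G.nonempty_trans
  ext i j
  rw [SimpleGraph.pathGraph_adj]
  simp only [GCSystem.commGraph, SimpleGraph.fromRel_adj]
  constructor
  · rintro ⟨hne, ⟨_, h⟩ | ⟨_, h⟩⟩ <;> cases h <;> simp at hne ⊢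
  · intro h
    refine ⟨by rintro rfl; omega, ?_⟩
    have h01 : G.toGCSystem.Edge 0 1 := ⟨_, Controlled.a01 r⟩
    have h12 : G.toGCSystem.Edge 1 2 := ⟨_, Controlled.a12 r⟩
    have h23 : G.toGCSystem.Edge 2 3 := ⟨_, Controlled.a23 r⟩
    fin_cases i <;> fin_cases j <;> simp at h <;> first | exact .inl ‹_› | exact .inr ‹_›

/-! ### Soundness of the simulation -/

/-- The configurations that occur in the simulation of a linear automaton. -/
inductive Good : Fin 4 → List G.Letter → Prop
  | state {s p} (h : G.Reach s p) : Good 0 (p.1.map lft ++ ([st s] ++ p.2.map rgt))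
  | a1 {r p} (h : G.Reach (G.source r) p) :
      Good 1 (p.1.map lft ++ ([st (G.source r), a₀ r] ++ p.2.map rgt))
  | a2 {r p} (h : G.Reach (G.source r) p) :
      Good 2 (p.1.map lft ++ ([st (G.source r), a₀ r, a₁ r] ++ p.2.map rgt))
  | a3 {r p} (h : G.Reach (G.source r) p) : Good 3 (p.1.map lft ++ ([a₁ r] ++ p.2.map rgt))
  | a4 {r p} (h : G.Reach (G.source r) p) : Good 2 (p.1.map lft ++ ([a₁ r, a₂ r] ++ p.2.map rgt))
  | a5 {r p} (h : G.Reach (G.source r) p) :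
      Good 1 (p.1.map lft ++ ([a₁ r, a₂ r, br r] ++ p.2.map rgt))
  | b0 {r p} (h : G.Reach (G.source r) p) : Good 0 (p.1.map lft ++ ([br r] ++ p.2.map rgt))
  | b1 {r p} (h : G.Reach (G.source r) p) : Good 1 (p.1.map lft ++ ([br r, b₀ r] ++ p.2.map rgt))
  | b2 {r p} (h : G.Reach (G.source r) p) :
      Good 2 (p.1.map lft ++ ([br r, b₀ r, G.fst r] ++ p.2.map rgt))
  | b3 {r p} (h : G.Reach (G.source r) p) :
      Good 3 (p.1.map lft ++ ([br r, G.fst r] ++ p.2.map rgt))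
  | b4 {r p} (h : G.Reach (G.source r) p) :
      Good 2 (p.1.map lft ++ ([br r, b₁ r, G.fst r] ++ p.2.map rgt))
  | b5 {r p} (h : G.Reach (G.source r) p) :
      Good 1 (p.1.map lft ++ ([br r, b₁ r, G.snd r, G.fst r] ++ p.2.map rgt))
  | cancel {l k q} (h : G.Reach G.final (l ++ k, k.reverse.map .inl ++ q)) :
      Good 0 (l.map lft ++ q.map rgt)

end LinearAutomaton

/-- A symbol that occurs in `A ++ (B ++ C)` but not in `A` and `C` occurs in `B`. -/
theorem eq_append_cons_of_notMem {α : Type*} {c : α} {A B C x y : List α}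
    (h : A ++ (B ++ C) = x ++ c :: y) (hA : c ∉ A) (hC : c ∉ C) :
    ∃ m₁ m₂, B = m₁ ++ c :: m₂ ∧ x = A ++ m₁ ∧ y = m₂ ++ C := by
  rcases List.append_eq_append_iff.1 h with ⟨u, rfl, h₁⟩ | ⟨u, rfl, h₁⟩
  · rcases List.append_eq_append_iff.1 h₁ with ⟨v, rfl, h₂⟩ | ⟨v, rfl, h₂⟩
    · exact (hC (h₂ ▸ by simp)).elim
    · cases v with
      | nil => exact (hC (by simp at h₂; simp [← h₂])).elim
      | cons d v =>
        simp only [List.cons_append, List.cons.injEq] at h₂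
        exact ⟨u, v, by simp [h₂.1], rfl, h₂.2⟩
  · cases u with
    | nil =>
      cases B with
      | nil => exact (hC (by simp at h₁; simp [← h₁])).elim
      | cons d B =>
        simp only [List.nil_append, List.cons_append, List.cons.injEq] at h₁
        exact ⟨[], B, by simp [h₁.1], by simp, h₁.2⟩
    | cons d u =>
      simp only [List.cons_append, List.cons.injEq] at h₁
      exact (hA (by simp [h₁.1])).elim

namespace LinearAutomaton

open Letter

variable {Γ τ : Type} {G : LinearAutomaton Γ (Γ ⊕ τ)}

theorem eq_of_cancel_eq {l : List Γ} {q : List (Γ ⊕ τ)} {a : Γ} {b : Γ ⊕ τ}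
    {x₁ x₂ : List G.Letter} (h : l.map lft ++ q.map rgt = x₁ ++ lft a :: rgt b :: x₂) :
    ∃ l' q', l = l' ++ [a] ∧ q = b :: q' ∧ x₁ = l'.map lft ∧ x₂ = q'.map rgt := by
  induction l generalizing x₁ with
  | nil =>
    have : lft a ∈ q.map (rgt : _ → G.Letter) := by
      rw [List.map_nil, List.nil_append] at h
      simp [h]
    simp at this
  | cons c l ih =>
    rcases x₁ with _ | ⟨d, x₁⟩
    · simp only [List.map_cons, List.cons_append, List.nil_append, List.cons.injEq, lft.injEq] at h
      obtain ⟨rfl, h⟩ := h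
      rcases l with _ | ⟨c', l⟩
      · rcases q with _ | ⟨c', q⟩
        · simp at h
        · simp only [List.map_nil, List.nil_append, List.map_cons, List.cons.injEq, rgt.injEq] at h
          exact ⟨[], q, by simp, by simp [h.1], rfl, h.2.symm⟩
      · simp at h
    · simp only [List.map_cons, List.cons_append, List.cons.injEq] at h
      obtain ⟨l', q', rfl, rfl, rfl, rfl⟩ := ih h.2
      exact ⟨c :: l', q', by simp [← h.1]⟩

/-- The middle symbol separates left letters from right letters, so no cancellation can happen
before the state is deleted. -/
theorem ne_of_cancel {l : List Γ} {q : List (Γ ⊕ τ)} {a : Γ} {b : Γ ⊕ τ} {m : G.Letter}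
    (h₁ : ∀ a, m ≠ lft a) (h₂ : ∀ b, m ≠ rgt b) {x₁ x₂ : List G.Letter} :
    l.map lft ++ ([m] ++ q.map rgt) ≠ x₁ ++ lft a :: rgt b :: x₂ := by
  induction l generalizing x₁ with
  | nil =>
    intro h
    rcases x₁ with _ | ⟨d, x₁⟩
    · simp [h₁] at h
    · have h : q.map rgt = x₁ ++ lft a :: rgt b :: x₂ := by simpa using (List.cons.inj h).2
      have : lft a ∈ q.map (rgt : _ → G.Letter) := by simp [h]
      simp at this
  | cons c l ih =>
    intro h
    rcases x₁ with _ | ⟨d, x₁⟩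
    · rcases l with _ | ⟨c', l⟩
      · simp [h₂] at h
      · simp at h
    · exact ih (List.cons.inj h).2

/-- The rule determines the place where it applies, since its symbols can only lie in the short
middle block. There a rule of the wrong transition or stage finds no match, and the right one leads
to the next listed form. -/
theorem Good.step {i j : Fin 4} {r : Rule G.Letter} {x y : List G.Letter} (hx : G.Good i x)
    (hr : G.Controlled i r j) (hy : r.Rewrites x y) : G.Good j y := by
  cases hx with
  | state h =>
    cases hr with
    | a01 r =>
      obtain ⟨x₁, x₂, h₁, rfl⟩ := insAfter_rewrites.1 hy
      obtain ⟨m₁, m₂, h₂, rfl, rfl⟩ := eq_append_cons_of_notMem h₁ (by simp) (by simp)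
      rcases m₁ with _ | ⟨_, _ | ⟨_, m₁⟩⟩ <;> simp at h₂
      obtain ⟨rfl, rfl⟩ := h₂
      simpa using Good.a1 h
    | b01 r =>
      obtain ⟨x₁, x₂, h₁, rfl⟩ := insAfter_rewrites.1 hy
      obtain ⟨m₁, m₂, h₂, rfl, rfl⟩ := eq_append_cons_of_notMem h₁ (by simp) (by simp)
      rcases m₁ with _ | ⟨_, _ | ⟨_, m₁⟩⟩ <;> simp at h₂
    | final =>
      obtain ⟨x₁, x₂, h₁, rfl⟩ := delOne_rewrites.1 hy
      obtain ⟨m₁, m₂, h₂, rfl, rfl⟩ := eq_append_cons_of_notMem h₁ (by simp) (by simp)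
      rcases m₁ with _ | ⟨_, _ | ⟨_, m₁⟩⟩ <;> simp at h₂
      obtain ⟨rfl, rfl⟩ := h₂
      simpa using Good.cancel (k := []) (by simpa using h)
    | cancel a =>
      obtain ⟨x₁, x₂, h₁, rfl⟩ := delTwo_rewrites.1 hy
      exact (ne_of_cancel (by simp) (by simp) h₁).elim
  | b0 h =>
    cases hr with
    | b01 r =>
      obtain ⟨x₁, x₂, h₁, rfl⟩ := insAfter_rewrites.1 hy
      obtain ⟨m₁, m₂, h₂, rfl, rfl⟩ := eq_append_cons_of_notMem h₁ (by simp) (by simp)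
      rcases m₁ with _ | ⟨_, _ | ⟨_, m₁⟩⟩ <;> simp at h₂
      obtain ⟨rfl, rfl⟩ := h₂
      simpa using Good.b1 h
    | a01 r =>
      obtain ⟨x₁, x₂, h₁, rfl⟩ := insAfter_rewrites.1 hy
      obtain ⟨m₁, m₂, h₂, rfl, rfl⟩ := eq_append_cons_of_notMem h₁ (by simp) (by simp)
      rcases m₁ with _ | ⟨_, _ | ⟨_, m₁⟩⟩ <;> simp at h₂
    | final =>
      obtain ⟨x₁, x₂, h₁, rfl⟩ := delOne_rewrites.1 hy
      obtain ⟨m₁, m₂, h₂, rfl, rfl⟩ := eq_append_cons_of_notMem h₁ (by simp) (by simp)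
      rcases m₁ with _ | ⟨_, _ | ⟨_, m₁⟩⟩ <;> simp at h₂
    | cancel a =>
      obtain ⟨x₁, x₂, h₁, rfl⟩ := delTwo_rewrites.1 hy
      exact (ne_of_cancel (by simp) (by simp) h₁).elim
  | @cancel l k q h =>
    cases hr with
    | cancel a =>
      obtain ⟨x₁, x₂, h₁, rfl⟩ := delTwo_rewrites.1 hy
      obtain ⟨l', q', rfl, rfl, rfl, rfl⟩ := eq_of_cancel_eq h₁
      exact Good.cancel (k := a :: k) (by simpa using h)
    | a01 r =>
      obtain ⟨x₁, x₂, h₁, rfl⟩ := insAfter_rewrites.1 hy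
      have : st (G.source r) ∈ l.map lft ++ q.map rgt := by simp [h₁]
      simp at this
    | b01 r =>
      obtain ⟨x₁, x₂, h₁, rfl⟩ := insAfter_rewrites.1 hy
      have : br r ∈ l.map lft ++ q.map rgt := by simp [h₁]
      simp at this
    | final =>
      obtain ⟨x₁, x₂, h₁, rfl⟩ := delOne_rewrites.1 hy
      have : st G.final ∈ l.map lft ++ q.map rgt := by simp [h₁]
      simp at this
  | _ h =>
    rename_i r₀ p
    rcases he : G.emit r₀ with a | b <;> cases hr <;>
    first
    | obtain ⟨x₁, x₂, h₁, rfl⟩ := insAfter_rewrites.1 hy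
      obtain ⟨m₁, m₂, h₂, rfl, rfl⟩ := eq_append_cons_of_notMem h₁ (by simp) (by simp)
      rcases m₁ with _ | ⟨_, _ | ⟨_, _ | ⟨_, _ | ⟨_, m₁⟩⟩⟩⟩ <;> simp [fst, snd, he] at h₂ <;> done
    | obtain ⟨x₁, x₂, h₁, rfl⟩ := delTwo_rewrites.1 hy
      obtain ⟨m₁, m₂, h₂, rfl, h₃⟩ := eq_append_cons_of_notMem h₁ (by simp) (by simp)
      rcases m₁ with _ | ⟨_, _ | ⟨_, _ | ⟨_, _ | ⟨_, m₁⟩⟩⟩⟩ <;> simp [fst, snd, he] at h₂ <;> done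
    -- The first letter of the pair may be present without the second, such as `br r` without `b₁
    -- r`; here the second letter is located instead.
    | obtain ⟨x₁, x₂, h₁, rfl⟩ := delTwo_rewrites.1 hy
      rw [List.append_cons] at h₁
      obtain ⟨m₁, m₂, h₂, h₃, rfl⟩ := eq_append_cons_of_notMem h₁ (by simp) (by simp)
      rcases m₁ with _ | ⟨_, _ | ⟨_, _ | ⟨_, _ | ⟨_, m₁⟩⟩⟩⟩ <;> simp [fst, snd, he] at h₂ <;> done
    | obtain ⟨x₁, x₂, h₁, rfl⟩ := delOne_rewrites.1 hy
      obtain ⟨m₁, m₂, h₂, rfl, rfl⟩ := eq_append_cons_of_notMem h₁ (by simp) (by simp)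
      rcases m₁ with _ | ⟨_, _ | ⟨_, _ | ⟨_, _ | ⟨_, m₁⟩⟩⟩⟩ <;> simp [fst, he] at h₂ <;> done
    | obtain ⟨x₁, x₂, h₁, rfl⟩ := insAfter_rewrites.1 hy
      obtain ⟨m₁, m₂, h₂, rfl, rfl⟩ := eq_append_cons_of_notMem h₁ (by simp) (by simp)
      rcases m₁ with _ | ⟨_, _ | ⟨_, _ | ⟨_, _ | ⟨_, m₁⟩⟩⟩⟩ <;> simp [fst, he] at h₂
      obtain ⟨rfl, rfl, rfl⟩ := h₂
      first
      | simpa [fst, snd, he] using Good.a2 h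
      | simpa [fst, snd, he] using Good.a4 h
      | simpa [fst, snd, he] using Good.a5 h
      | simpa [fst, snd, he] using Good.b2 h
      | simpa [fst, snd, he] using Good.b4 h
      | simpa [fst, snd, he] using Good.b5 h
    | obtain ⟨x₁, x₂, h₁, rfl⟩ := delTwo_rewrites.1 hy
      obtain ⟨m₁, m₂, h₂, rfl, h₃⟩ := eq_append_cons_of_notMem h₁ (by simp) (by simp)
      rcases m₁ with _ | ⟨_, _ | ⟨_, _ | ⟨_, _ | ⟨_, m₁⟩⟩⟩⟩ <;> simp [fst, snd, he] at h₂
      rw [← h₂.2] at h₃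
      simp only [List.cons_append, List.nil_append, List.cons.injEq] at h₃
      rw [h₃.2]
      first
      | simpa [fst, snd, he] using Good.a3 h
      | simpa [fst, snd, he] using Good.b0 h
      | simpa [fst, snd, he, write] using Good.state (.step r₀ h)
    | obtain ⟨x₁, x₂, h₁, rfl⟩ := delOne_rewrites.1 hy
      obtain ⟨m₁, m₂, h₂, rfl, rfl⟩ := eq_append_cons_of_notMem h₁ (by simp) (by simp)
      rcases m₁ with _ | ⟨_, _ | ⟨_, _ | ⟨_, _ | ⟨_, m₁⟩⟩⟩⟩ <;> simp [fst, he] at h₂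
      obtain ⟨rfl, rfl, rfl⟩ := h₂
      simpa [fst, snd, he] using Good.b3 h

end LinearAutomaton

/-! ### Completeness of the simulation and the generated language -/

namespace LinearAutomaton

open Letter Relation

variable {Γ τ : Type} [Finite Γ] [Finite τ] {G : LinearAutomaton Γ (Γ ⊕ τ)}

theorem step_insAfter {i j : Fin 4} {c a : G.Letter} (h : G.Controlled i (insAfter c a) j)
    (x y : List G.Letter) : G.toGCSystem.Step (i, x ++ c :: y) (j, x ++ c :: a :: y) :=
  ⟨_, h, insAfter_rewrites.2 ⟨x, y, rfl, rfl⟩⟩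

theorem step_delOne {i j : Fin 4} {a : G.Letter} (h : G.Controlled i (delOne a) j)
    (x y : List G.Letter) : G.toGCSystem.Step (i, x ++ a :: y) (j, x ++ y) :=
  ⟨_, h, delOne_rewrites.2 ⟨x, y, rfl, rfl⟩⟩

theorem step_delTwo {i j : Fin 4} {a b : G.Letter} (h : G.Controlled i (delTwo a b) j)
    (x y : List G.Letter) : G.toGCSystem.Step (i, x ++ a :: b :: y) (j, x ++ y) :=
  ⟨_, h, delTwo_rewrites.2 ⟨x, y, rfl, rfl⟩⟩

/-- First trip: `s`, `s a₀`, `s a₀ a₁`, `a₁`, `a₁ a₂`, `a₁ a₂ br`, `br`. Second trip: `br`, `br b₀`,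
`br b₀ fst`, `br fst`, `br b₁ fst`, `br b₁ snd fst`, `snd fst`. Insertions go directly after their
context, hence `fst` precedes `snd` in time and follows it in the string. -/
theorem reflTransGen_transition (r : G.Trans) (x y : List G.Letter) :
    ReflTransGen G.toGCSystem.Step (0, x ++ st (G.source r) :: y)
      (0, x ++ G.snd r :: G.fst r :: y) := by
  refine .head (step_insAfter (.a01 r) _ _) ?_
  rw [List.append_cons]
  refine .head (step_insAfter (.a12 r) _ _) ?_
  rw [← List.append_cons]
  refine .head (step_delTwo (.a23 r) _ _) <| .head (step_insAfter (.a32 r) _ _) ?_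
  rw [List.append_cons]
  refine .head (step_insAfter (.a21 r) _ _) ?_
  rw [← List.append_cons]
  refine .head (step_delTwo (.a10 r) _ _) <| .head (step_insAfter (.b01 r) _ _) ?_
  rw [List.append_cons]
  refine .head (step_insAfter (.b12 r) _ _) <| .head (step_delOne (.b23 r) _ _) ?_
  rw [← List.append_cons]
  refine .head (step_insAfter (.b32 r) _ _) ?_
  rw [List.append_cons]
  refine .head (step_insAfter (.b21 r) _ _) ?_
  rw [← List.append_cons]
  exact .single (step_delTwo (.b10 r) _ _)

theorem Reach.reflTransGen {s : G.State} {p} (h : G.Reach s p) :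
    ReflTransGen G.toGCSystem.Step (0, [st G.start]) (0, p.1.map lft ++ st s :: p.2.map rgt) := by
  induction h with
  | start => exact .refl
  | @step r p _ ih =>
    refine ih.trans ?_
    convert reflTransGen_transition r _ _ using 2
    rcases he : G.emit r with a | b <;> simp [write, fst, snd, he]

theorem reflTransGen_cancel (l : List Γ) (y : List G.Letter) :
    ReflTransGen G.toGCSystem.Step
      (0, l.map lft ++ (l.reverse.map fun a ↦ rgt (.inl a)) ++ y) (0, y) := by
  induction l using List.reverseRecOn with
  | nil => exact .refl
  | append_singleton l a ih =>
    refine .head ?_ ih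
    simpa using step_delTwo (.cancel a) (l.map lft) ((l.reverse.map fun a ↦ rgt (.inl a)) ++ y)

theorem Good.of_reflTransGen {c d : Fin 4 × List G.Letter} (hc : G.Good c.1 c.2)
    (h : ReflTransGen G.toGCSystem.Step c d) : G.Good d.1 d.2 := by
  induction h with
  | refl => exact hc
  | tail _ h ih =>
    obtain ⟨r, hr, h⟩ := h
    exact ih.step hr h

theorem mem_language_toGCSystem {w : List τ} : w ∈ G.toGCSystem.language ↔
    ∃ l, G.Reach G.final (l, l.reverse.map .inl ++ w.map .inr) := by
  constructor
  · rintro ⟨_, rfl, h⟩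
    have hg : G.Good 0 (w.map fun t ↦ rgt (.inr t)) :=
      Good.of_reflTransGen (c := (0, [st G.start])) (by simpa using Good.state .start) h
    generalize hv : (w.map fun t ↦ (rgt (.inr t) : G.Letter)) = v at hg
    cases hg with
    | @state s p _ =>
      have : st s ∈ w.map fun t ↦ (rgt (.inr t) : G.Letter) := by rw [hv]; simp
      simp at this
    | @b0 r p _ =>
      have : br r ∈ w.map fun t ↦ (rgt (.inr t) : G.Letter) := by rw [hv]; simp
      simp at this
    | @cancel l k q h =>
      rcases l with _ | ⟨a, l⟩
      · refine ⟨k, ?_⟩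
        have hq : q = w.map .inr := by
          have hi : Function.Injective (rgt : Γ ⊕ τ → G.Letter) := fun a b h ↦ by simpa using h
          refine List.map_injective_iff.2 hi ?_
          simpa [Function.comp_def] using hv.symm
        simpa [hq] using h
      · have : lft a ∈ w.map fun t ↦ (rgt (.inr t) : G.Letter) := by rw [hv]; simp
        simp at this
  · rintro ⟨l, h⟩
    refine ⟨_, rfl, h.reflTransGen.trans <| .head (step_delOne .final _ _) ?_⟩
    have := reflTransGen_cancel (G := G) l (w.map fun t ↦ rgt (.inr t))
    simp only [List.map_append, List.map_map]
    rwa [List.append_assoc] at this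

end LinearAutomaton

theorem mem_linearTCL_of_automaton {Γ τ : Type} [Finite Γ] [Finite τ]
    (G : LinearAutomaton Γ (Γ ⊕ τ)) :
    {w : List τ | ∃ l, G.Reach G.final (l, l.reverse.map .inl ++ w.map .inr)} ∈
      LinearTCL τ 4 1 1 0 2 0 0 :=
  ⟨4, le_rfl, G.toGCSystem, by rw [G.toGCSystem_commGraph]; exact ⟨.refl⟩, G.toGCSystem_sizeLE,
    Set.ext fun _ ↦ LinearAutomaton.mem_language_toGCSystem⟩

/-- Transfers the result to terminal alphabets in any universe; the constructions need an alphabet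
in `Type`. -/
theorem mem_linearTCL_of_equiv {T : Type*} {τ : Type} (e : T ≃ τ) {k n m m' p q q' : ℕ}
    {L : Language τ} (h : L ∈ LinearTCL τ k n m m' p q q') :
    {w : List T | w.map e ∈ L} ∈ LinearTCL T k n m m' p q q' := by
  obtain ⟨l, hl, P, hP, hs, rfl⟩ := h
  refine ⟨l, hl, ⟨P.V, P.finite_alphabet, e.toEmbedding.trans P.terminal, P.initials,
    P.finite_initials, P.initialComp, P.finalComp, P.rules, P.finite_rules⟩, hP, hs, ?_⟩
  ext w
  change (∃ x ∈ P.initials, Relation.ReflTransGen P.Step _ (_, w.map (P.terminal ∘ e))) ↔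
    ∃ x ∈ P.initials, Relation.ReflTransGen P.Step _ (_, (w.map e).map P.terminal)
  rw [List.map_map]

/-! ### Generated languages are recursively enumerable -/

theorem rePred_exists {α δ : Type*} [Primcodable α] [Primcodable δ] {f : α → δ → Bool}
    (hf : Computable₂ f) : REPred fun a ↦ ∃ d, f a d = true := by
  have hg : Computable₂ fun (a : α) (k : ℕ) ↦
      (Encodable.decode k : Option δ).bind fun d ↦ bif f a d then some () else none := by
    refine Computable.option_bind (Computable.decode.comp Computable.snd) ?_
    exact Computable.cond (hf.comp (Computable.fst.comp Computable.fst) Computable.snd)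
      (Computable.const _) (Computable.const _)
  refine (Partrec.rfindOpt hg).dom_re.of_eq fun a ↦ ?_
  rw [Nat.rfindOpt_dom]
  constructor
  · rintro ⟨k, u, h⟩
    obtain ⟨d, -, h⟩ := Option.bind_eq_some_iff.1 h
    refine ⟨d, ?_⟩
    cases hd : f a d <;> simp_all
  · rintro ⟨d, h⟩
    exact ⟨Encodable.encode d, (), by simp [h]⟩

/-- The string that is rewritten by a rule. -/
def Rule.lhs {V : Type} (r : Rule V) : List V :=
  match r.kind with
  | .ins => r.left ++ r.right
  | .del => r.left ++ r.str ++ r.right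

/-- The string that results from the string that is rewritten by a rule. -/
def Rule.rhs {V : Type} (r : Rule V) : List V :=
  match r.kind with
  | .ins => r.left ++ r.str ++ r.right
  | .del => r.left ++ r.right

theorem Rule.rewrites_iff {V : Type} {r : Rule V} {x y : List V} :
    r.Rewrites x y ↔ ∃ x₁ x₂, x = x₁ ++ r.lhs ++ x₂ ∧ y = x₁ ++ r.rhs ++ x₂ := by
  unfold Rewrites lhs rhs
  cases r.kind <;> simp

namespace GCSystem

variable {T : Type*} {k : ℕ} (P : GCSystem T k)

open scoped Classical in
/-- The configuration after the transition by a given rule at a given place, if there is one. -/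
noncomputable def apply (c : Option (Fin k × List P.V)) (d : P.rules × List P.V × List P.V) :
    Option (Fin k × List P.V) :=
  if c = some (d.1.1.1, d.2.1 ++ d.1.1.2.1.lhs ++ d.2.2) then
    some (d.1.1.2.2, d.2.1 ++ d.1.1.2.1.rhs ++ d.2.2)
  else none

/-- A derivation becomes a list of rules with their left and right surroundings. Checking it is a
fold, hence primitive recursive. -/
theorem reflTransGen_step_iff {c d : Fin k × List P.V} :
    Relation.ReflTransGen P.Step c d ↔ ∃ t, List.foldl P.apply (some c) t = some d := by
  constructor
  · intro h
    induction h with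
    | refl => exact ⟨[], rfl⟩
    | @tail d e _ h ih =>
      obtain ⟨t, ht⟩ := ih
      obtain ⟨r, hr, h⟩ := h
      obtain ⟨x₁, x₂, h₁, h₂⟩ := Rule.rewrites_iff.1 h
      refine ⟨t ++ [(⟨_, hr⟩, x₁, x₂)], ?_⟩
      rw [List.foldl_append, ht, List.foldl_cons, List.foldl_nil, apply, if_pos (by rw [← h₁]),
        ← h₂]
  · rintro ⟨t, ht⟩
    induction t using List.reverseRecOn generalizing d with
    | nil =>
      obtain rfl : c = d := by simpa using ht
      exact .refl
    | append_singleton t e ih =>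
      rw [List.foldl_append, List.foldl_cons, List.foldl_nil, apply] at ht
      split_ifs at ht with h
      refine (ih h).tail ⟨e.1.1.2.1, ?_, Rule.rewrites_iff.2 ⟨_, _, rfl, ?_⟩⟩
      · obtain rfl := Option.some.inj ht
        exact e.1.2
      · obtain rfl := Option.some.inj ht
        rfl

theorem language_mem_RE [Finite T] [Primcodable T] : P.language ∈ RE T := by
  classical
  have := P.finite_alphabet
  have := P.finite_rules.to_subtype
  have := P.finite_initials.to_subtype
  obtain ⟨n₁, ⟨e₁⟩⟩ := Finite.exists_equiv_fin P.V
  obtain ⟨n₂, ⟨e₂⟩⟩ := Finite.exists_equiv_fin P.rules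
  obtain ⟨n₃, ⟨e₃⟩⟩ := Finite.exists_equiv_fin P.initials
  let : Primcodable P.V := Primcodable.ofEquiv _ e₁
  let : Primcodable P.rules := Primcodable.ofEquiv _ e₂
  let : Primcodable P.initials := Primcodable.ofEquiv _ e₃
  have happly : Primrec₂ P.apply := by
    refine Primrec.ite ?_ ?_ (Primrec.const _)
    · refine Primrec.eq.comp Primrec.fst (Primrec.option_some.comp (Primrec.pair ?_ ?_))
      · exact (Primrec.dom_finite fun r : P.rules ↦ r.1.1).comp (Primrec.fst.comp Primrec.snd)
      · refine Primrec.list_append.comp (Primrec.list_append.comp ?_ ?_) ?_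
        · exact Primrec.fst.comp (Primrec.snd.comp Primrec.snd)
        · exact (Primrec.dom_finite fun r : P.rules ↦ r.1.2.1.lhs).comp
            (Primrec.fst.comp Primrec.snd)
        · exact Primrec.snd.comp (Primrec.snd.comp Primrec.snd)
    · refine Primrec.option_some.comp (Primrec.pair ?_ ?_)
      · exact (Primrec.dom_finite fun r : P.rules ↦ r.1.2.2).comp (Primrec.fst.comp Primrec.snd)
      · refine Primrec.list_append.comp (Primrec.list_append.comp ?_ ?_) ?_
        · exact Primrec.fst.comp (Primrec.snd.comp Primrec.snd)
        · exact (Primrec.dom_finite fun r : P.rules ↦ r.1.2.1.rhs).comp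
            (Primrec.fst.comp Primrec.snd)
        · exact Primrec.snd.comp (Primrec.snd.comp Primrec.snd)
  have hf : Primrec₂ fun (w : List T) (d : P.initials × List (P.rules × List P.V × List P.V)) ↦
      decide (d.2.foldl P.apply (some (P.initialComp, d.1.1)) =
        some (P.finalComp, w.map P.terminal)) := by
    refine Primrec.eq.decide.comp ?_ ?_
    · refine Primrec.list_foldl (h := fun _ b ↦ P.apply b.1 b.2)
        (f := fun a : List T × P.initials × List (P.rules × List P.V × List P.V) ↦ a.2.2)
        (Primrec.snd.comp Primrec.snd) ?_ ?_
      · exact Primrec.option_some.comp (Primrec.pair (Primrec.const _)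
          ((Primrec.dom_finite fun x : P.initials ↦ x.1).comp (Primrec.fst.comp Primrec.snd)))
      · exact happly.comp₂ (Primrec.fst.comp₂ Primrec₂.right) (Primrec.snd.comp₂ Primrec₂.right)
    · exact Primrec.option_some.comp (Primrec.pair (Primrec.const _)
        (Primrec.list_map Primrec.fst ((Primrec.dom_finite P.terminal).comp Primrec.snd)))
  refine (rePred_exists hf.to_comp).of_eq fun w ↦ ?_
  simp only [decide_eq_true_eq, Prod.exists, ← P.reflTransGen_step_iff, Subtype.exists, exists_prop]
  rfl

end GCSystem

/-! ### Automata that write blocks of letters -/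

open LinearAutomaton (write)

/-- A linear automaton that writes a word of letters in each transition. -/
structure BlockAutomaton (Γ ρ : Type) where
  /-- The states. -/
  State : Type
  /-- The transitions. -/
  Trans : Type
  [finite_state : Finite State]
  [finite_trans : Finite Trans]
  [nonempty_trans : Nonempty Trans]
  /-- The source of a transition. -/
  source : Trans → State
  /-- The target of a transition. -/
  target : Trans → State
  /-- The letters that are written. -/
  emit : Trans → List (Γ ⊕ ρ)
  emit_ne_nil : ∀ r, emit r ≠ []
  /-- The initial state. -/
  start : State
  /-- The final state. -/
  final : State

namespace BlockAutomaton

attribute [instance] finite_state finite_trans nonempty_trans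

variable {Γ ρ : Type}

/-- The effect of writing a word of letters. -/
def writeAll (x : List (Γ ⊕ ρ)) (p : List Γ × List ρ) : List Γ × List ρ :=
  x.foldl (fun p e ↦ write e p) p

theorem writeAll_append (x y : List (Γ ⊕ ρ)) (p : List Γ × List ρ) :
    writeAll (x ++ y) p = writeAll y (writeAll x p) :=
  List.foldl_append

theorem writeAll_map_inl (x : List Γ) (p : List Γ × List ρ) :
    writeAll (x.map .inl) p = (p.1 ++ x, p.2) := by
  induction x generalizing p with
  | nil => simp [writeAll]
  | cons a x ih =>
    have := ih (write (.inl a) p)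
    simpa [writeAll, write] using this

theorem writeAll_map_inr (x : List ρ) (p : List Γ × List ρ) :
    writeAll (x.map .inr) p = (p.1, x.reverse ++ p.2) := by
  induction x generalizing p with
  | nil => simp [writeAll]
  | cons a x ih =>
    have := ih (write (.inr a) p)
    simpa [writeAll, write] using this

/-- `B.Reach s p`: the automaton can get to the state `s` while writing the two words of `p`. -/
inductive Reach (B : BlockAutomaton Γ ρ) : B.State → List Γ × List ρ → Prop
  | start : Reach B B.start ([], [])
  | step (r : B.Trans) {p} :
      Reach B (B.source r) p → Reach B (B.target r) (writeAll (B.emit r) p)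

/-- The states also store the part of the current block that is still to be written. -/
theorem exists_linearAutomaton [Finite Γ] [Finite ρ] (B : BlockAutomaton Γ ρ) :
    ∃ G : LinearAutomaton Γ ρ, ∀ p, G.Reach G.final p ↔ B.Reach B.final p := by
  obtain ⟨K, hK⟩ := (Set.finite_range fun r ↦ (B.emit r).length).bddAbove
  have hK (r) : (B.emit r).length ≤ K := hK ⟨r, rfl⟩
  have (n : ℕ) : Finite {x : List (Γ ⊕ ρ) // x.length ≤ n} := List.finite_length_le _ n
  have (n : ℕ) : Finite {x : List (Γ ⊕ ρ) // x.length + 1 ≤ n} :=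
    (List.finite_length_le (Γ ⊕ ρ) n).subset fun x hx ↦ (Nat.le_succ _).trans hx
  let G : LinearAutomaton Γ ρ :=
    { State := {x : List (Γ ⊕ ρ) // x.length ≤ K} × B.State
      Trans := B.Trans ⊕ (Γ ⊕ ρ) × {x : List (Γ ⊕ ρ) // x.length + 1 ≤ K} × B.State
      source := Sum.elim (fun r ↦ (⟨[], K.zero_le⟩, B.source r))
        fun d ↦ (⟨d.1 :: d.2.1.1, d.2.1.2⟩, d.2.2)
      target := Sum.elim
        (fun r ↦ (⟨(B.emit r).tail, by have := hK r; simp; omega⟩, B.target r))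
        fun d ↦ (⟨d.2.1.1, (Nat.le_succ _).trans d.2.1.2⟩, d.2.2)
      emit := Sum.elim (fun r ↦ (B.emit r).head (B.emit_ne_nil r)) fun d ↦ d.1
      start := (⟨[], K.zero_le⟩, B.start)
      final := (⟨[], K.zero_le⟩, B.final) }
  -- The invariant treats the stored rest of the block as already written.
  have sound {s p} (h : G.Reach s p) : B.Reach s.2 (writeAll s.1.1 p) := by
    induction h with
    | start => exact .start
    | @step r p _ ih =>
      rcases r with r | ⟨e, x, c⟩
      · have := Reach.step r ih
        rw [← List.cons_head_tail (B.emit_ne_nil r)] at this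
        exact this
      · exact ih
  have finish {x : List (Γ ⊕ ρ)} (hx : x.length ≤ K) {c : B.State} {p}
      (h : G.Reach (⟨x, hx⟩, c) p) : G.Reach (⟨[], K.zero_le⟩, c) (writeAll x p) := by
    induction x generalizing p with
    | nil => exact h
    | cons e x ih =>
      exact ih ((Nat.le_succ _).trans hx)
        (LinearAutomaton.Reach.step (G := G) (.inr (e, ⟨x, hx⟩, c)) h)
  have complete {c p} (h : B.Reach c p) : G.Reach (⟨[], K.zero_le⟩, c) p := by
    induction h with
    | start => exact .start
    | @step r p _ ih =>
      have := finish _ (LinearAutomaton.Reach.step (G := G) (.inl r) ih)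
      change G.Reach _ (writeAll (B.emit r).tail (writeAll [(B.emit r).head (B.emit_ne_nil r)] p))
        at this
      rwa [← writeAll_append, List.singleton_append, List.cons_head_tail] at this
  exact ⟨G, fun p ↦ ⟨sound, complete⟩⟩

end BlockAutomaton

/-! ### Queue systems -/

/-- A nondeterministic machine whose memory is a queue: in one step the word `rhs i` is appended
and then the word `lhs i` is removed at the front. -/
structure QueueSystem (Γ τ : Type) where
  /-- The steps. -/
  Rule : Type
  /-- The accepting conditions. -/
  Halt : Type
  [finite_rule : Finite Rule]
  [finite_halt : Finite Halt]
  /-- The word that is removed at the front. -/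
  lhs : Rule → List Γ
  /-- The word that is appended. -/
  rhs : Rule → List Γ
  lhs_ne_nil : ∀ i, lhs i ≠ []
  length_le : ∀ i, (lhs i).length ≤ (rhs i).length
  /-- A queue that begins with this word is accepted. -/
  halt : Halt → List Γ
  halt_ne_nil : ∀ i, halt i ≠ []
  /-- The first part of the initial queue. -/
  pre : List Γ
  pre_ne_nil : pre ≠ []
  /-- The code of an input letter. -/
  code : τ → List Γ
  /-- The last part of the initial queue. -/
  suf : List Γ
  suf_ne_nil : suf ≠ []

namespace QueueSystem

attribute [instance] finite_rule finite_halt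

variable {Γ τ : Type} (Q : QueueSystem Γ τ)

/-- The queues that occur for the input `w`, which is stored in reverse order. -/
inductive Reach (w : List τ) : List Γ → Prop
  | init : Reach w (Q.pre ++ w.reverse.flatMap Q.code ++ Q.suf)
  | step (i : Q.Rule) {s s' : List Γ} : Reach w s → s ++ Q.rhs i = Q.lhs i ++ s' → Reach w s'

/-- The input `w` is accepted. -/
def Accepts (w : List τ) : Prop := ∃ i s, Q.Reach w (Q.halt i ++ s)

/-- The phases of the guess of a computation of a queue system. -/
inductive Phase
  | start
  | input
  | run
  | clear

instance : Finite Phase :=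
  Finite.of_surjective (fun i : Fin 4 ↦ ![Phase.start, .input, .run, .clear] i) fun x ↦ by
    cases x
    exacts [⟨0, rfl⟩, ⟨1, rfl⟩, ⟨2, rfl⟩, ⟨3, rfl⟩]

/-- The transitions of the block automaton of a queue system. -/
inductive Block
  | start
  | read (t : τ)
  | close
  | rule (i : Q.Rule)
  | halt (i : Q.Halt)
  | clear (a : Γ)

instance [Finite Γ] [Finite τ] : Finite Q.Block := by
  let f : Fin 2 ⊕ τ ⊕ Q.Rule ⊕ Q.Halt ⊕ Γ → Q.Block :=
    Sum.elim ![.start, .close] <| Sum.elim .read <| Sum.elim .rule <| Sum.elim .halt .clear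
  refine Finite.of_surjective f fun x ↦ ?_
  cases x with
  | start => exact ⟨.inl 0, rfl⟩
  | close => exact ⟨.inl 1, rfl⟩
  | read t => exact ⟨.inr (.inl t), rfl⟩
  | rule i => exact ⟨.inr (.inr (.inl i)), rfl⟩
  | halt i => exact ⟨.inr (.inr (.inr (.inl i))), rfl⟩
  | clear a => exact ⟨.inr (.inr (.inr (.inr a))), rfl⟩

/-- The block automaton that guesses a computation of a queue system. It writes on the left the
letters that are appended to the queue, and on the right the letters that are removed. -/
def toBlockAutomaton [Finite Γ] [Finite τ] : BlockAutomaton Γ (Γ ⊕ τ) where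
  State := Phase
  Trans := Q.Block
  nonempty_trans := ⟨.start⟩
  source
    | .start => .start
    | .read _ | .close => .input
    | .rule _ | .halt _ => .run
    | .clear _ => .clear
  target
    | .start | .read _ => .input
    | .close | .rule _ => .run
    | .halt _ | .clear _ => .clear
  emit
    | .start => Q.pre.map .inl
    | .read t => [.inr t].map .inr ++ (Q.code t).map .inl
    | .close => Q.suf.map .inl
    | .rule i => (Q.rhs i).map .inl ++ ((Q.lhs i).map .inl).map .inr
    | .halt i => ((Q.halt i).map .inl).map .inr
    | .clear a => ([a].map .inl).map .inr
  emit_ne_nil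
    | .start => by simpa using Q.pre_ne_nil
    | .read t => by simp
    | .close => by simpa using Q.suf_ne_nil
    | .rule i => by simp [Q.lhs_ne_nil]
    | .halt i => by simp [Q.halt_ne_nil]
    | .clear a => by simp
  start := .start
  final := .clear

variable {Q} [Finite Γ] [Finite τ]

open BlockAutomaton

section

variable (Q) (p : List Γ × List (Γ ⊕ τ))

theorem writeAll_emit_start :
    writeAll (Q.toBlockAutomaton.emit .start) p = (p.1 ++ Q.pre, p.2) :=
  writeAll_map_inl _ _

theorem writeAll_emit_read (t : τ) :
    writeAll (Q.toBlockAutomaton.emit (.read t)) p = (p.1 ++ Q.code t, .inr t :: p.2) := by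
  refine (writeAll_append _ _ _).trans ?_
  rw [writeAll_map_inl, writeAll_map_inr]
  rfl

theorem writeAll_emit_close :
    writeAll (Q.toBlockAutomaton.emit .close) p = (p.1 ++ Q.suf, p.2) :=
  writeAll_map_inl _ _

theorem writeAll_emit_rule (i : Q.Rule) : writeAll (Q.toBlockAutomaton.emit (.rule i)) p =
    (p.1 ++ Q.rhs i, (Q.lhs i).reverse.map .inl ++ p.2) := by
  refine (writeAll_append _ _ _).trans ?_
  rw [writeAll_map_inl, writeAll_map_inr, List.map_reverse]

theorem writeAll_emit_halt (i : Q.Halt) : writeAll (Q.toBlockAutomaton.emit (.halt i)) p =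
    (p.1, (Q.halt i).reverse.map .inl ++ p.2) := by
  refine (writeAll_map_inr _ _).trans ?_
  rw [List.map_reverse]

theorem writeAll_emit_clear (a : Γ) :
    writeAll (Q.toBlockAutomaton.emit (.clear a)) p = (p.1, .inl a :: p.2) :=
  writeAll_map_inr _ _

end

/-- What the automaton has written when it is in a given phase. -/
def Written (Q : QueueSystem Γ τ) (p : List Γ × List (Γ ⊕ τ)) : Phase → Prop
  | .start => p = ([], [])
  | .input => ∃ w : List τ, p = (Q.pre ++ w.reverse.flatMap Q.code, w.map .inr)
  | .run => ∃ (w : List τ) (k : List Γ), p.2 = k.reverse.map .inl ++ w.map .inr ∧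
      k.length ≤ p.1.length ∧ ∀ s, p.1 = k ++ s → Q.Reach w s
  | .clear => ∃ (w : List τ) (k : List Γ), p.2 = k.reverse.map .inl ++ w.map .inr ∧
      ∀ s, p.1 = k ++ s → Q.Accepts w

/-- The automaton never compares its two words, so the invariant is conditional: if the removed
letters `k` form a prefix of the appended ones, the rest is a reachable queue. -/
theorem written_of_reach {c : Q.toBlockAutomaton.State} {p}
    (h : Q.toBlockAutomaton.Reach c p) : Q.Written p c := by
  induction h with
  | start => rfl
  | @step r p _ ih =>
    cases r with
    | start =>
      obtain rfl : p = ([], []) := ih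
      exact ⟨[], by simp [toBlockAutomaton, writeAll_map_inl]⟩
    | read t =>
      obtain ⟨w, rfl⟩ := ih
      refine ⟨t :: w, ?_⟩
      rw [writeAll_emit_read]
      simp
    | close =>
      obtain ⟨w, rfl⟩ := ih
      refine ⟨w, [], ?_⟩
      rw [writeAll_emit_close]
      refine ⟨rfl, Nat.zero_le _, ?_⟩
      rintro s rfl
      exact .init
    | rule i =>
      obtain ⟨w, k, h₁, h₂, h₃⟩ := ih
      refine ⟨w, k ++ Q.lhs i, ?_⟩
      rw [writeAll_emit_rule]
      refine ⟨by simp [h₁], ?_, fun s hs ↦ ?_⟩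
      · have := Q.length_le i
        simp only [List.length_append]
        omega
      · change p.1 ++ Q.rhs i = k ++ Q.lhs i ++ s at hs
        rw [List.append_assoc] at hs
        -- The previous queue must exist too: `k` is no longer than `p.1` because no rule removes
        -- more than it appends.
        obtain ⟨s', hs'⟩ : ∃ s', p.1 = k ++ s' :=
          (List.prefix_of_prefix_length_le (hs ▸ List.prefix_append _ _ : k <+: p.1 ++ Q.rhs i)
            (List.prefix_append _ _) h₂).imp fun _ h ↦ h.symm
        refine .step i (h₃ s' hs') ?_
        rw [hs', List.append_assoc] at hs
        exact List.append_cancel_left hs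
    | halt i =>
      obtain ⟨w, k, h₁, h₂, h₃⟩ := ih
      refine ⟨w, k ++ Q.halt i, ?_⟩
      rw [writeAll_emit_halt]
      exact ⟨by simp [h₁], fun s hs ↦ ⟨i, s, h₃ _ (by simpa using hs)⟩⟩
    | clear a =>
      obtain ⟨w, k, h₁, h₂⟩ := ih
      refine ⟨w, k ++ [a], ?_⟩
      rw [writeAll_emit_clear]
      exact ⟨by simp [h₁], fun s hs ↦ h₂ (a :: s) (by simpa using hs)⟩

theorem map_inl_append_map_inr_inj {α β : Type*} {a a' : List α} {b b' : List β}
    (h : a.map Sum.inl ++ b.map Sum.inr = a'.map Sum.inl ++ b'.map Sum.inr) : a = a' ∧ b = b' := by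
  constructor
  · simpa [List.filterMap_map, Function.comp_def] using congrArg (List.filterMap Sum.getLeft?) h
  · simpa [List.filterMap_map, Function.comp_def] using congrArg (List.filterMap Sum.getRight?) h

theorem reach_input (w : List τ) : Q.toBlockAutomaton.Reach .input
    (Q.pre ++ w.reverse.flatMap Q.code, w.map .inr) := by
  induction w with
  | nil =>
    have : Q.toBlockAutomaton.Reach .input _ :=
      BlockAutomaton.Reach.step (B := Q.toBlockAutomaton) .start .start
    rw [writeAll_emit_start] at this
    simpa using this
  | cons t w ih =>
    have : Q.toBlockAutomaton.Reach .input _ :=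
      BlockAutomaton.Reach.step (B := Q.toBlockAutomaton) (.read t) ih
    rw [writeAll_emit_read] at this
    simpa using this

theorem Reach.reach_run {w : List τ} {s : List Γ} (h : Q.Reach w s) :
    ∃ k, Q.toBlockAutomaton.Reach .run (k ++ s, k.reverse.map .inl ++ w.map .inr) := by
  induction h with
  | init =>
    have : Q.toBlockAutomaton.Reach .run _ :=
      BlockAutomaton.Reach.step (B := Q.toBlockAutomaton) .close (reach_input w)
    rw [writeAll_emit_close] at this
    exact ⟨[], this⟩
  | @step i s s' _ hs ih =>
    obtain ⟨k, ih⟩ := ih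
    have : Q.toBlockAutomaton.Reach .run _ :=
      BlockAutomaton.Reach.step (B := Q.toBlockAutomaton) (.rule i) ih
    rw [writeAll_emit_rule] at this
    refine ⟨k ++ Q.lhs i, ?_⟩
    simpa [hs] using this

/-- After acceptance the remaining queue is emptied, so that the two words agree in full. -/
theorem reach_clear {w : List τ} {k s : List Γ}
    (h : Q.toBlockAutomaton.Reach .clear (k ++ s, k.reverse.map .inl ++ w.map .inr)) :
    Q.toBlockAutomaton.Reach .clear (k ++ s, (k ++ s).reverse.map .inl ++ w.map .inr) := by
  induction s generalizing k with
  | nil => simpa using h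
  | cons a s ih =>
    have : Q.toBlockAutomaton.Reach .clear _ :=
      BlockAutomaton.Reach.step (B := Q.toBlockAutomaton) (.clear a) h
    rw [writeAll_emit_clear] at this
    simpa using ih (k := k ++ [a]) (by simpa using this)

theorem accepts_iff {w : List τ} : Q.Accepts w ↔
    ∃ l, Q.toBlockAutomaton.Reach .clear (l, l.reverse.map .inl ++ w.map .inr) := by
  constructor
  · rintro ⟨i, s, h⟩
    obtain ⟨k, h⟩ := h.reach_run
    have : Q.toBlockAutomaton.Reach .clear _ :=
      BlockAutomaton.Reach.step (B := Q.toBlockAutomaton) (.halt i) h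
    rw [writeAll_emit_halt] at this
    exact ⟨_, reach_clear (k := k ++ Q.halt i) (s := s) (by simpa using this)⟩
  · rintro ⟨l, h⟩
    obtain ⟨w', k, h₁, h₂⟩ := written_of_reach h
    obtain ⟨hk, rfl⟩ := map_inl_append_map_inr_inj h₁
    exact h₂ [] (by simpa using hk)

theorem mem_linearTCL (Q : QueueSystem Γ τ) :
    {w | Q.Accepts w} ∈ LinearTCL τ 4 1 1 0 2 0 0 := by
  obtain ⟨G, hG⟩ := Q.toBlockAutomaton.exists_linearAutomaton
  convert mem_linearTCL_of_automaton G using 2 with w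
  simp only [hG]
  exact funext fun _ ↦ propext accepts_iff

end QueueSystem

/-! ### Turing machines in a queue -/

open Turing

/-- The letters of a queue that contains the configuration of a Turing machine. -/
inductive QueueLetter (Γ Λ : Type)
  | cell (a : Γ)
  | state (q : Λ)
  | mark

namespace QueueLetter

instance {Γ Λ : Type} [Finite Γ] [Finite Λ] : Finite (QueueLetter Γ Λ) := by
  let f : Option (Γ ⊕ Λ) → QueueLetter Γ Λ
    | none => .mark
    | some (.inl a) => .cell a
    | some (.inr q) => .state q
  refine Finite.of_surjective f fun x ↦ ?_
  cases x with
  | cell a => exact ⟨some (.inl a), rfl⟩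
  | state q => exact ⟨some (.inr q), rfl⟩
  | mark => exact ⟨none, rfl⟩

variable {Γ Λ : Type}

/-- The queue for a state `q` and a tape with the cells `L.reverse` on the left of the head and
`R` from the head to the right. -/
def word (q : Λ) (L R : List Γ) : List (QueueLetter Γ Λ) :=
  state q :: (R.map cell ++ mark :: (L.map cell).reverse)

/-- Used with the state letter, which occurs once: it fixes where the cyclic word is cut. -/
theorem cons_isRotated_cons {α : Type*} {a b : α} {x y : List α} (h : a :: x ~r b :: y)
    (hy : a ∉ y) : a = b ∧ x = y := by
  obtain ⟨n, hn, h⟩ := List.isRotated_iff_mod.1 h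
  rw [List.rotate_eq_drop_append_take hn] at h
  rcases n with _ | n
  · simpa using h
  · rcases hd : x.drop n with _ | ⟨c, d⟩
    · rw [List.drop_succ_cons, List.take_succ_cons, hd, List.nil_append, List.cons.injEq] at h
      refine ⟨h.1, h.2 ▸ ?_⟩
      rw [List.take_of_length_le (List.drop_eq_nil_iff.1 hd)]
    · rw [List.drop_succ_cons, List.take_succ_cons, hd, List.cons_append, List.cons.injEq] at h
      exact absurd (h.2 ▸ by simp) hy

theorem isRotated_of_eq_append {α : Type*} {l l' x y : List α} (h : l = x ++ y)
    (h' : l' = y ++ x) : l ~r l' := by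
  rw [h, h']
  exact List.isRotated_append

theorem word_isRotated_inj {q q' : Λ} {x : List (QueueLetter Γ Λ)} {L R : List Γ}
    (h : state q :: x ~r word q' L R) : q = q' ∧ x = R.map cell ++ mark :: (L.map cell).reverse :=
  (cons_isRotated_cons h (by simp)).imp (fun h ↦ by simpa using h) id

end QueueLetter

open QueueLetter

variable {Γ Λ τ : Type} [Inhabited Γ] [Inhabited Λ]

/-- The rules for the simulation of a Turing machine in a queue. -/
inductive QueueRule (M : TM0.Machine Γ Λ) : List (QueueLetter Γ Λ) → List (QueueLetter Γ Λ) → Prop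
  | rotate (x) : QueueRule M [x] [x]
  | write {q a q' b} (h : M q a = some (q', .write b)) :
      QueueRule M [state q, cell a] [state q', cell b]
  | right {q a q'} (h : M q a = some (q', .move .right)) :
      QueueRule M [state q, cell a] [cell a, state q']
  | left {q a q'} (h : M q a = some (q', .move .left)) (c) :
      QueueRule M [cell c, state q, cell a] [state q', cell c, cell a]
  | blankRight (q) : QueueRule M [state q, mark] [state q, cell default, mark]
  | blankLeft (q) : QueueRule M [mark, state q] [mark, cell default, state q]

/-- The queue system that simulates a Turing machine. -/
def queueSystem [Finite Γ] [Finite Λ] (M : TM0.Machine Γ Λ) (pre : List Γ) (code : τ → List Γ) :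
    QueueSystem (QueueLetter Γ Λ) τ where
  Rule := {p : List (QueueLetter Γ Λ) × List (QueueLetter Γ Λ) // QueueRule M p.1 p.2}
  Halt := {p : Λ × Γ // M p.1 p.2 = none}
  finite_rule := by
    have h := List.finite_length_le (QueueLetter Γ Λ) 3
    refine ((h.prod h).subset ?_).to_subtype
    rintro ⟨_, _⟩ h
    cases h <;> simp
  lhs r := r.1.1
  rhs r := r.1.2
  lhs_ne_nil := by
    rintro ⟨⟨_, _⟩, h⟩
    cases h <;> simp
  length_le := by
    rintro ⟨⟨_, _⟩, h⟩
    cases h <;> simp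
  halt p := [state p.1.1, cell p.1.2]
  halt_ne_nil := by simp
  pre := state default :: pre.map cell
  pre_ne_nil := by simp
  code t := (code t).map cell
  suf := [mark]
  suf_ne_nil := by simp

namespace QueueSystem

variable {M : TM0.Machine Γ Λ}

/-- The queue `s` represents the configuration `c`, up to rotation. -/
def Represents (s : List (QueueLetter Γ Λ)) (c : TM0.Cfg Γ Λ) : Prop :=
  ∃ q L R, s ~r word q L R ∧ c = ⟨q, Tape.mk' (.mk L) (.mk R)⟩

theorem mk_singleton_default : ListBlank.mk [(default : Γ)] = ListBlank.mk [] :=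
  Quotient.sound' (.inr ⟨1, rfl⟩)

/-- Read cyclically, the letter before the state is the cell left of the head. Rotations and blanks
added next to `mark` do not change the configuration; the other rules are machine steps. -/
theorem Represents.step {x y u : List (QueueLetter Γ Λ)} {c : TM0.Cfg Γ Λ} (hr : QueueRule M x y)
    (h : Represents (x ++ u) c) : ∃ d, TM0.Reaches M c d ∧ Represents (u ++ y) d := by
  obtain ⟨q₀, L, R, h, rfl⟩ := h
  cases hr with
  | rotate x => exact ⟨_, .refl, q₀, L, R, (List.isRotated_concat _ _).trans h, rfl⟩
  | @write q a q' b hM =>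
    obtain ⟨rfl, e⟩ := word_isRotated_inj h
    rcases R with _ | ⟨a, R⟩ <;> simp at e
    obtain ⟨rfl, rfl⟩ := e
    refine ⟨⟨q', Tape.mk' (.mk L) (.mk (b :: R))⟩, .single ?_, q', L, b :: R, ?_, rfl⟩
    · simp [TM0.step, hM, ← ListBlank.cons_mk]
    · exact List.isRotated_append (l' := [state q', cell b])
  | @right q a q' hM =>
    obtain ⟨rfl, e⟩ := word_isRotated_inj h
    rcases R with _ | ⟨a, R⟩ <;> simp at e
    obtain ⟨rfl, rfl⟩ := e
    refine ⟨⟨q', Tape.mk' (.mk (a :: L)) (.mk R)⟩, .single ?_, q', a :: L, R, ?_, rfl⟩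
    · simp [TM0.step, hM, ← ListBlank.cons_mk]
    · exact isRotated_of_eq_append (x := R.map cell ++ mark :: ((L.map cell).reverse ++ [cell a]))
        (y := [state q']) (by simp) (by simp [word])
  | @left q a q' hM c =>
    replace h := (List.isRotated_append (l := [state q, cell a] ++ u) (l' := [cell c])).trans h
    obtain ⟨rfl, e⟩ := word_isRotated_inj h
    rcases R with _ | ⟨a, R⟩ <;> simp at e
    obtain ⟨rfl, e⟩ := e
    rcases L with _ | ⟨b, L⟩
    -- With no stored cell on the left, the letter before the state would be `mark`.
    · simpa using (List.append_inj' e rfl).2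
    replace e : u ++ [cell c] = (R.map cell ++ mark :: (L.map cell).reverse) ++ [cell b] := by
      simpa using e
    obtain ⟨rfl, e⟩ := List.append_inj' e rfl
    obtain rfl : c = b := by simpa using e
    refine ⟨⟨q', Tape.mk' (.mk L) (.mk (c :: a :: R))⟩, .single ?_, q', L, c :: a :: R, ?_, rfl⟩
    · simp [TM0.step, hM, ← ListBlank.cons_mk]
    · exact List.isRotated_append (l' := [state q', cell c, cell a])
  | blankRight q =>
    obtain ⟨rfl, e⟩ := word_isRotated_inj h
    rcases R with _ | ⟨a, R⟩ <;> simp at e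
    obtain rfl := e
    refine ⟨_, .refl, q, L, [default], ?_, ?_⟩
    · exact List.isRotated_append (l' := [state q, cell default, mark])
    · rw [mk_singleton_default]
  | blankLeft q =>
    replace h := (List.isRotated_append (l := [state q] ++ u) (l' := [mark])).trans h
    obtain ⟨rfl, e⟩ := word_isRotated_inj h
    rcases L with _ | ⟨c, L⟩
    · obtain rfl : u = R.map cell := by simpa using e
      refine ⟨_, .refl, q, [default], R, ?_, ?_⟩
      · exact isRotated_of_eq_append (x := R.map cell ++ [mark, cell default]) (y := [state q])
          (by simp) (by simp [word])
      · rw [mk_singleton_default]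
    · replace e : u ++ [mark] = (R.map cell ++ mark :: (L.map cell).reverse) ++ [cell c] := by
        simpa using e
      simpa using (List.append_inj' e rfl).2

variable [Finite Γ] [Finite Λ] {pre : List Γ} {code : τ → List Γ}
  {w : List τ} {s : List (QueueLetter Γ Λ)}

theorem Reach.replace {x y u : List (QueueLetter Γ Λ)} (hr : QueueRule M x y)
    (h : (queueSystem M pre code).Reach w (x ++ u)) :
    (queueSystem M pre code).Reach w (u ++ y) :=
  h.step (Q := queueSystem M pre code) ⟨(x, y), hr⟩ (List.append_assoc _ _ _)

theorem Reach.of_isRotated {s' : List (QueueLetter Γ Λ)}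
    (h : (queueSystem M pre code).Reach w s) (hs : s ~r s') :
    (queueSystem M pre code).Reach w s' := by
  obtain ⟨n, rfl⟩ := hs
  induction n with
  | zero => simpa using h
  | succ n ih =>
    rw [← List.rotate_rotate]
    rcases hx : s.rotate n with _ | ⟨x, u⟩
    · simpa [hx] using ih
    · rw [hx] at ih
      simpa using Reach.replace (.rotate x) ih

/-- Left sides of rules have at most three letters, so a step removes letters of the old queue only,
never part of the word just appended. -/
theorem Reach.three_le_length (hp : pre ≠ []) (h : (queueSystem M pre code).Reach w s) :
    3 ≤ s.length := by
  induction h with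
  | init =>
    have := List.length_pos_iff.2 hp
    simp only [queueSystem, List.length_append, List.length_cons, List.length_map]
    omega
  | @step i s s' _ hs ih =>
    have h₁ := (queueSystem M pre code).length_le i
    have h₂ := congrArg List.length hs
    simp only [List.length_append] at h₂
    omega

theorem Reach.represents (hp : pre ≠ []) (h : (queueSystem M pre code).Reach w s) :
    ∃ c, TM0.Reaches M (TM0.init (pre ++ w.reverse.flatMap code)) c ∧ Represents s c := by
  induction h with
  | init =>
    refine ⟨_, .refl, default, [], pre ++ w.reverse.flatMap code, ?_, rfl⟩
    refine isRotated_of_eq_append (x := word default [] (pre ++ w.reverse.flatMap code)) (y := [])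
      ?_ rfl
    simp [queueSystem, word, List.map_flatMap]
  | @step i s s' h hs ih =>
    obtain ⟨c, hc, ih⟩ := ih
    have hl : ((queueSystem M pre code).lhs i).length ≤ s.length := by
      refine le_trans ?_ (h.three_le_length hp)
      obtain ⟨⟨_, _⟩, h⟩ := i
      cases h <;> simp [queueSystem]
    obtain ⟨u, rfl⟩ := List.prefix_of_prefix_length_le
      ⟨s', hs.symm⟩ (List.prefix_append s _) hl
    rw [List.append_assoc] at hs
    obtain rfl := List.append_cancel_left hs
    obtain ⟨d, hd, h⟩ := ih.step i.2
    exact ⟨d, hc.trans hd, h⟩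

theorem exists_reach_word {c : TM0.Cfg Γ Λ}
    (h : TM0.Reaches M (TM0.init (pre ++ w.reverse.flatMap code)) c) :
    ∃ a L R, (queueSystem M pre code).Reach w (word c.q L (a :: R)) ∧
      c.Tape = Tape.mk' (.mk L) (.mk (a :: R)) := by
  -- A machine step needs an explicit cell under the head, and a left move one beside it; missing
  -- blanks are created first.
  have extend {q L R} (h : (queueSystem M pre code).Reach w (word q L R)) :
      ∃ a R', (queueSystem M pre code).Reach w (word q L (a :: R')) ∧
        ListBlank.mk (a :: R') = ListBlank.mk R := by
    rcases R with _ | ⟨a, R⟩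
    · refine ⟨default, [], ?_, mk_singleton_default⟩
      exact (Reach.replace (.blankRight q) h).of_isRotated
        (List.isRotated_append (l' := [state q, cell default, mark]))
    · exact ⟨a, R, h, rfl⟩
  have extendLeft {q L R} (h : (queueSystem M pre code).Reach w (word q L R)) :
      ∃ a L', (queueSystem M pre code).Reach w (word q (a :: L') R) ∧
        ListBlank.mk (a :: L') = ListBlank.mk L := by
    rcases L with _ | ⟨a, L⟩
    · refine ⟨default, [], ?_, mk_singleton_default⟩
      have := h.of_isRotated (s' := [mark, state q] ++ R.map cell)
        (by simpa [word] using List.isRotated_append (l := state q :: R.map cell) (l' := [mark]))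
      refine (Reach.replace (.blankLeft q) this).of_isRotated ?_
      exact isRotated_of_eq_append (x := R.map cell ++ [mark, cell default]) (y := [state q])
        (by simp) (by simp [word])
    · exact ⟨a, L, h, rfl⟩
  induction h with
  | refl =>
    have : (queueSystem M pre code).Reach w (word default [] (pre ++ w.reverse.flatMap code)) := by
      simpa [queueSystem, word, List.map_flatMap] using Reach.init (Q := queueSystem M pre code)
    obtain ⟨a, R, h, e⟩ := extend this
    exact ⟨a, [], R, h, by rw [e]; rfl⟩
  | @tail c d _ hd ih =>
    obtain ⟨a, L, R, h, e⟩ := ih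
    obtain ⟨q, T⟩ := c
    obtain rfl : T = _ := e
    obtain ⟨⟨q', act⟩, hM, rfl⟩ := Option.map_eq_some_iff.1 hd
    replace hM : M q a = some (q', act) := by simpa using hM
    rcases act with (_ | _) | b
    · obtain ⟨c, L', h, e⟩ := extendLeft h
      have h' := h.of_isRotated
        (s' := [cell c, state q, cell a] ++ (R.map cell ++ mark :: (L'.map cell).reverse))
        (isRotated_of_eq_append (y := [cell c])
          (x := state q :: cell a :: (R.map cell ++ mark :: (L'.map cell).reverse))
          (by simp [word]) (by simp))
      refine ⟨c, L', a :: R, (Reach.replace (.left hM c) h').of_isRotated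
        (List.isRotated_append (l' := [state q', cell c, cell a])), ?_⟩
      simp [← e, ← ListBlank.cons_mk]
    · have h' : (queueSystem M pre code).Reach w (word q' (a :: L) R) :=
        (Reach.replace (.right hM) h).of_isRotated <| isRotated_of_eq_append
          (x := R.map cell ++ mark :: ((L.map cell).reverse ++ [cell a])) (y := [state q'])
          (by simp) (by simp [word])
      obtain ⟨a', R', h', e⟩ := extend h'
      refine ⟨a', a :: L, R', h', ?_⟩
      rw [e]
      simp [← ListBlank.cons_mk]
    · refine ⟨b, L, R, (Reach.replace (.write hM) h).of_isRotated
        (List.isRotated_append (l' := [state q', cell b])), ?_⟩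
      simp [← ListBlank.cons_mk]

theorem accepts_queueSystem_iff (hp : pre ≠ []) :
    (queueSystem M pre code).Accepts w ↔ (TM0.eval M (pre ++ w.reverse.flatMap code)).Dom := by
  change _ ↔ (StateTransition.eval (TM0.step M) (TM0.init _)).Dom
  constructor
  · rintro ⟨⟨⟨q, a⟩, hM⟩, s, h⟩
    obtain ⟨c, hc, q', L, R, h, rfl⟩ := h.represents hp
    obtain ⟨rfl, e⟩ := word_isRotated_inj h
    rcases R with _ | ⟨a, R⟩ <;> simp at e
    obtain ⟨rfl, -⟩ := e
    refine Part.dom_iff_mem.2 ⟨_, StateTransition.mem_eval.2 ⟨hc, ?_⟩⟩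
    simpa [TM0.step] using hM
  · intro h
    obtain ⟨c, h⟩ := Part.dom_iff_mem.1 h
    obtain ⟨hc, h⟩ := StateTransition.mem_eval.1 h
    obtain ⟨a, L, R, hr, e⟩ := exists_reach_word hc
    refine ⟨⟨(c.q, a), ?_⟩, _, hr⟩
    have : (M c.q c.Tape.1) = none := Option.map_eq_none_iff.1 h
    simpa [e] using this

end QueueSystem

/-! ### Turing machines for recursively enumerable sets -/

open Turing

/-- Restricts the states to a finite closed set by sending all outside states to the default one. -/
theorem exists_finite_machine {Γ Λ : Type} [Inhabited Γ] [Inhabited Λ] (M : TM0.Machine Γ Λ)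
    {S : Set Λ} (hS : S.Finite) (h : TM0.Supports M S) :
    ∃ (Λ' : Type) (_ : Inhabited Λ') (_ : Finite Λ') (M' : TM0.Machine Γ Λ'),
      ∀ l, (TM0.eval M' l).Dom ↔ (TM0.eval M l).Dom := by
  classical
  let : Inhabited S := ⟨default, h.1⟩
  let f : PointedMap Γ Γ := ⟨id, rfl⟩
  let g : PointedMap Λ S := ⟨fun q ↦ if hq : q ∈ S then ⟨q, hq⟩ else default, dif_pos h.1⟩
  refine ⟨S, inferInstance, hS.to_subtype, M.map f f g Subtype.val, fun l ↦ ?_⟩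
  refine StateTransition.tr_eval_dom (TM0.Machine.map_respects M f f g Subtype.val h
    (fun _ ↦ rfl) fun q hq ↦ congrArg Subtype.val (dif_pos hq)) ⟨h.1, ?_⟩
  rw [TM0.map_init]
  exact congrArg TM0.init (List.map_id l)

theorem exists_machine_of_code (c : ToPartrec.Code) :
    ∃ (Λ : Type) (_ : Inhabited Λ) (_ : Finite Λ)
      (M : TM0.Machine (TM2to1.Γ' PartrecToTM2.K' fun _ ↦ PartrecToTM2.Γ') Λ),
      ∀ v, (TM0.eval M (TM2to1.trInit PartrecToTM2.K'.main (PartrecToTM2.trList v))).Dom ↔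
        (c.eval v).Dom := by
  -- The default state is where a `TM2` machine starts, so it must be the entry point of `c`.
  let : Inhabited PartrecToTM2.Λ' := ⟨PartrecToTM2.trNormal c .halt⟩
  have h₁ : TM2.Supports PartrecToTM2.tr (PartrecToTM2.codeSupp c .halt) :=
    PartrecToTM2.tr_supports c .halt
  have h₂ := TM1to0.tr_supports _ (TM2to1.tr_supports _ h₁)
  obtain ⟨Λ, i, j, M, hM⟩ := exists_finite_machine _ (Finset.finite_toSet _) h₂
  refine ⟨Λ, i, j, M, fun v ↦ ?_⟩
  refine (hM _).trans <| (iff_of_eq (congrArg Part.Dom (TM1to0.tr_eval _ _))).trans <|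
    (TM2to1.tr_eval_dom _ _ _).trans ?_
  have h := PartrecToTM2.tr_eval c v
  have hi : PartrecToTM2.init c v = TM2.init PartrecToTM2.K'.main (PartrecToTM2.trList v) := by
    unfold PartrecToTM2.init TM2.init
    congr 1
    ext k : 1
    cases k <;> rfl
  change (StateTransition.eval (TM2.step PartrecToTM2.tr)
    (TM2.init PartrecToTM2.K'.main (PartrecToTM2.trList v))).Dom ↔ _
  rw [← hi, h]
  rfl

/-- The code of a word as a positive natural number. -/
def wordCode {T : Type*} [Encodable T] (w : List T) : ℕ :=
  w.foldr (fun a n ↦ 2 ^ Encodable.encode a * (2 * n + 1)) 1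

section

variable {T : Type*} [Encodable T]

@[simp]
theorem wordCode_cons (a : T) (w : List T) :
    wordCode (a :: w) = 2 ^ Encodable.encode a * (2 * wordCode w + 1) := rfl

theorem wordCode_pos (w : List T) : 0 < wordCode w := by
  cases w
  · exact Nat.one_pos
  · rw [wordCode_cons]
    positivity

theorem two_pow_mul_odd_inj {k l m n : ℕ} (h : 2 ^ k * (2 * m + 1) = 2 ^ l * (2 * n + 1)) :
    k = l ∧ m = n := by
  induction k generalizing l with
  | zero =>
    rcases l with _ | l
    · simpa using h
    · rw [pow_succ] at h
      have := congrArg (· % 2) h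
      simp [mul_comm _ 2, mul_assoc, Nat.add_mod] at this
  | succ k ih =>
    rcases l with _ | l
    · rw [pow_succ] at h
      have := congrArg (· % 2) h
      simp [mul_comm _ 2, mul_assoc, Nat.add_mod] at this
    · rw [pow_succ', pow_succ', mul_assoc, mul_assoc] at h
      simpa using ih (Nat.eq_of_mul_eq_mul_left two_pos h)

theorem wordCode_injective : Function.Injective (wordCode : List T → ℕ) := by
  have h (a : T) (w : List T) : wordCode (a :: w) ≠ 1 := by
    intro h
    have := wordCode_pos w
    have h' := two_pow_mul_odd_inj (l := 0) (n := 0) 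
      ((wordCode_cons a w).symm.trans (h.trans (by simp)))
    omega
  intro w
  induction w with
  | nil =>
    rintro (_ | ⟨a, w⟩) e
    · rfl
    · exact absurd e.symm (h a w)
  | cons a w ih =>
    rintro (_ | ⟨b, v⟩) e
    · exact absurd e (h a w)
    · obtain ⟨h₁, h₂⟩ := two_pow_mul_odd_inj e
      rw [Encodable.encode_injective h₁, ih h₂]

end

/-- Decoding is an unbounded search for a word with the given code, so `wordCode` need only be
primitive recursive and injective. -/
theorem exists_code_of_rePred {T : Type*} [Finite T] [Primcodable T] {p : List T → Prop}
    (hp : REPred p) : ∃ c : ToPartrec.Code, ∀ w, (c.eval [wordCode w]).Dom ↔ p w := by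
  have hw : Primrec (wordCode : List T → ℕ) := by
    refine Primrec.list_foldr .id (.const 1)
      (h := fun _ b ↦ 2 ^ Encodable.encode b.1 * (2 * b.2 + 1)) ?_
    refine Primrec.nat_mul.comp
      ((Primrec.dom_finite fun a : T ↦ 2 ^ Encodable.encode a).comp (.comp .fst .snd)) ?_
    exact Primrec.succ.comp (Primrec.nat_mul.comp (.const 2) (.comp .snd .snd))
  have hd : Primrec₂ fun (n k : ℕ) ↦ (Encodable.decode k : Option (List T)).bind fun w ↦
      if wordCode w = n then some w else none := by
    refine Primrec.option_bind (Primrec.decode.comp .snd) ?_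
    exact Primrec.ite (Primrec.eq.comp (hw.comp .snd) (.comp .fst .fst))
      (Primrec.option_some.comp .snd) (.const _)
  let g (n : ℕ) : Part (List T) := Nat.rfindOpt fun k ↦ (Encodable.decode k).bind fun w ↦
    if wordCode w = n then some w else none
  have hf : Partrec fun n ↦ (g n).bind fun w ↦
      (Part.assert (p w) fun _ ↦ Part.some ()).map fun _ ↦ 0 :=
    (Partrec.rfindOpt hd.to_comp).bind
      (Partrec.map (hp.comp Computable.snd) (Computable.const 0).to₂)
  obtain ⟨c, hc⟩ := ToPartrec.Code.exists_code (Nat.Partrec'.part_iff₁.2 hf)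
  refine ⟨c, fun w ↦ ?_⟩
  rw [show c.eval [wordCode w] = _ from hc (wordCode w ::ᵥ .nil)]
  change ((g (wordCode w)).bind fun w ↦
    (Part.assert (p w) fun _ ↦ Part.some ()).map fun _ ↦ 0).Dom ↔ _
  have mem {v : List T} (h : v ∈ g (wordCode w)) : v = w := by
    obtain ⟨k, hk⟩ := Nat.rfindOpt_spec h
    obtain ⟨u, -, hu⟩ := Option.bind_eq_some_iff.1 hk
    split_ifs at hu with e
    obtain rfl := Option.some.inj hu
    exact wordCode_injective e
  constructor
  · intro h
    obtain ⟨_, h⟩ := Part.dom_iff_mem.1 h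
    obtain ⟨v, hv, h⟩ := Part.mem_bind_iff.1 h
    obtain ⟨_, h, -⟩ := (Part.mem_map_iff _).1 h
    obtain ⟨h, -⟩ := Part.mem_assert_iff.1 h
    exact mem hv ▸ h
  · intro h
    obtain ⟨v, hv⟩ : ∃ v, v ∈ g (wordCode w) :=
      Part.dom_iff_mem.1 (Nat.rfindOpt_dom.2 ⟨Encodable.encode w, w, by simp⟩)
    obtain rfl := mem hv
    exact Part.dom_iff_mem.2 ⟨_, Part.mem_bind_iff.2 ⟨v, hv,
      Part.mem_map _ (Part.mem_assert h (Part.mem_some ()))⟩⟩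

theorem trNat_two_mul_add_one (n : ℕ) :
    PartrecToTM2.trNat (2 * n + 1) = .bit1 :: PartrecToTM2.trNat n := by
  unfold PartrecToTM2.trNat
  rw [two_mul, Nat.cast_add, Nat.cast_add, Nat.cast_one, Num.bit1_of_bit1]
  cases (n : Num) <;> rfl

theorem trNat_two_mul {n : ℕ} (hn : 0 < n) :
    PartrecToTM2.trNat (2 * n) = .bit0 :: PartrecToTM2.trNat n := by
  unfold PartrecToTM2.trNat
  rw [two_mul, Nat.cast_add, Num.bit0_of_bit0]
  cases h : (n : Num) with
  | zero =>
    have := Num.to_of_nat n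
    rw [h] at this
    exact absurd this hn.ne
  | pos p => rfl

theorem trNat_two_pow_mul {n : ℕ} (hn : 0 < n) (k : ℕ) :
    PartrecToTM2.trNat (2 ^ k * n) = List.replicate k .bit0 ++ PartrecToTM2.trNat n := by
  induction k with
  | zero => simp
  | succ k ih => rw [pow_succ', mul_assoc, trNat_two_mul (by positivity), ih]; rfl

/-- The reason for the choice of `wordCode`: in binary, highest bit first, each letter contributes
its own block, a one followed by zeros, as a queue system requires of its input. -/
theorem reverse_trNat_wordCode {T : Type*} [Encodable T] (w : List T) :
    (PartrecToTM2.trNat (wordCode w)).reverse =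
      .bit1 :: w.reverse.flatMap fun a ↦ .bit1 :: List.replicate (Encodable.encode a) .bit0 := by
  induction w with
  | nil =>
    rw [show wordCode ([] : List T) = 2 * 0 + 1 from rfl, trNat_two_mul_add_one,
      PartrecToTM2.trNat_zero]
    rfl
  | cons a w ih =>
    rw [wordCode_cons, trNat_two_pow_mul (Nat.succ_pos _), trNat_two_mul_add_one]
    simp [ih]

/-- A recursively enumerable set of words is the domain of a Turing machine that reads the words in
reverse order, with their letters encoded by words of tape symbols. -/
theorem exists_machine_of_rePred {T : Type*} [Finite T] [Primcodable T] {p : List T → Prop}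
    (hp : REPred p) :
    ∃ (Γ Λ : Type) (_ : Inhabited Γ) (_ : Finite Γ) (_ : Inhabited Λ) (_ : Finite Λ)
      (M : TM0.Machine Γ Λ) (pre : List Γ) (code : T → List Γ), pre ≠ [] ∧
      ∀ w, (TM0.eval M (pre ++ w.reverse.flatMap code)).Dom ↔ p w := by
  obtain ⟨c, hc⟩ := exists_code_of_rePred hp
  obtain ⟨Λ, i, j, M, hM⟩ := exists_machine_of_code c
  let cell (x : PartrecToTM2.Γ') : TM2to1.Γ' PartrecToTM2.K' fun _ ↦ PartrecToTM2.Γ' :=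
    (false, Function.update (fun _ ↦ none) PartrecToTM2.K'.main (some x))
  have hK : Finite PartrecToTM2.K' :=
    Finite.of_surjective ![PartrecToTM2.K'.main, .rev, .aux, .stack] fun k ↦ by
      cases k
      exacts [⟨0, rfl⟩, ⟨1, rfl⟩, ⟨2, rfl⟩, ⟨3, rfl⟩]
  have : Finite (TM2to1.Γ' PartrecToTM2.K' fun _ ↦ PartrecToTM2.Γ') :=
    inferInstanceAs (Finite (Bool × (PartrecToTM2.K' → Option PartrecToTM2.Γ')))
  -- The prefix holds the end-of-number symbol, flagged as bottom of the stack, and the leading bit,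
  -- which is the code of the empty word.
  refine ⟨_, Λ, inferInstance, this, i, j, M, [(true, (cell .cons).2), cell .bit1],
    fun a ↦ (.bit1 :: List.replicate (Encodable.encode a) .bit0 : List _).map cell, by simp,
    fun w ↦ ?_⟩
  rw [← hc, ← hM]
  have h₁ : TM2to1.trInit PartrecToTM2.K'.main (PartrecToTM2.trList [wordCode w]) =
      (true, (cell .cons).2) :: (PartrecToTM2.trNat (wordCode w)).reverse.map cell := by
    have : (PartrecToTM2.trList [wordCode w]).reverse =
      .cons :: (PartrecToTM2.trNat (wordCode w)).reverse := by simp [PartrecToTM2.trList]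
    unfold TM2to1.trInit
    rw [this]
    rfl
  have h₂ {α β γ : Type _} (f : α → β) (g : γ → List α) (a : α) (b : β) (l : List γ) :
      [b, f a] ++ l.flatMap (fun c ↦ (g c).map f) = b :: (a :: l.flatMap g).map f := by
    simp [List.map_flatMap]
  rw [h₁, reverse_trNat_wordCode]
  exact iff_of_eq (congrArg (fun l ↦ (TM0.eval M l).Dom) (h₂ _ _ _ _ _))

/-! ### The inclusions between the three families -/

theorem linearTCL_subset_RE {T : Type*} [Finite T] [Primcodable T] {k n m m' p q q' : ℕ} :
    LinearTCL T k n m m' p q q' ⊆ RE T := by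
  rintro _ ⟨l, -, P, -, -, rfl⟩
  exact P.language_mem_RE

theorem TCL_subset_RE {T : Type*} [Finite T] [Primcodable T] {k n m m' p q q' : ℕ} :
    TCL T k n m m' p q q' ⊆ RE T := by
  rintro _ ⟨l, -, P, -, -, rfl⟩
  exact P.language_mem_RE

theorem pathGraph_succ_isTree (n : ℕ) : (SimpleGraph.pathGraph (n + 1)).IsTree := by
  rw [SimpleGraph.isTree_iff_connected_and_card]
  refine ⟨SimpleGraph.pathGraph_connected n, ?_⟩
  have h : (SimpleGraph.pathGraph (n + 1)).edgeSet =
      Set.range fun i : Fin n ↦ s(i.castSucc, i.succ) := by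
    ext e
    induction e with | h x y
    rw [SimpleGraph.mem_edgeSet, SimpleGraph.pathGraph_adj, Set.mem_range]
    constructor
    · rintro (h | h)
      · exact ⟨⟨x, by omega⟩, Sym2.eq_iff.2 (.inl ⟨rfl, Fin.ext h⟩)⟩
      · exact ⟨⟨y, by omega⟩, Sym2.eq_iff.2 (.inr ⟨rfl, Fin.ext h⟩)⟩
    · rintro ⟨i, h⟩
      rcases Sym2.eq_iff.1 h with ⟨rfl, rfl⟩ | ⟨rfl, rfl⟩ <;> simp
  rw [h, Nat.card_range_of_injective, Nat.card_fin, Nat.card_fin]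
  intro i j h
  rcases Sym2.eq_iff.1 h with ⟨h, -⟩ | ⟨h, h'⟩
  · exact Fin.castSucc_injective n h
  · simp only [Fin.ext_iff, Fin.val_castSucc, Fin.val_succ] at h h'
    omega

theorem linearTCL_subset_TCL {T : Type*} {k n m m' p q q' : ℕ} :
    LinearTCL T k n m m' p q q' ⊆ TCL T k n m m' p q q' := by
  rintro _ ⟨l, hl, P, ⟨e⟩, hs, rfl⟩
  refine ⟨l, hl, P, e.isTree_iff.2 ?_, hs, rfl⟩
  rcases l with _ | l
  · exact P.initialComp.elim0
  · exact pathGraph_succ_isTree l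

theorem RE_subset_linearTCL {T : Type*} [Finite T] [Primcodable T] :
    RE T ⊆ LinearTCL T 4 1 1 0 2 0 0 := by
  intro L hL
  obtain ⟨Γ, Λ, _, _, _, _, M, pre, code, hp, hM⟩ := exists_machine_of_rePred hL
  obtain ⟨n, ⟨e⟩⟩ := Finite.exists_equiv_fin T
  have h := mem_linearTCL_of_equiv e (queueSystem M pre fun i ↦ code (e.symm i)).mem_linearTCL
  have hL : L = {w | w.map e ∈ {w | (queueSystem M pre fun i ↦ code (e.symm i)).Accepts w}} := by
    ext w
    change w ∈ L ↔ (queueSystem M pre fun i ↦ code (e.symm i)).Accepts (w.map e)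
    rw [QueueSystem.accepts_queueSystem_iff hp, ← List.map_reverse, List.flatMap_map]
    simpa using (hM w).symm
  rw [hL]
  exact h

end InsDel

theorem theorem1 (T : Type*) [Finite T] [Primcodable T] :
    InsDel.TCL T 4 1 1 0 2 0 0 = InsDel.RE T ∧
      InsDel.LinearTCL T 4 1 1 0 2 0 0 = InsDel.RE T :=
  ⟨InsDel.TCL_subset_RE.antisymm
    (InsDel.RE_subset_linearTCL.trans InsDel.linearTCL_subset_TCL),
    InsDel.linearTCL_subset_RE.antisymm InsDel.RE_subset_linearTCL⟩
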